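/- Let $(M^n,g)$ be a smooth Riemannian manifold of dimension $n\ge 3$, with Levi-Civita connection $\nabla$ and curvature tensor $R(X,Y,Z,T)=g(\nabla_X\nabla_YZ-\nabla_Y\nabla_XZ-\nabla_{[X,Y]}Z,T)$. Let $\mathrm{Ric}(X,Y)=\mathrm{tr}\{V\mapsto R_{V,X}Y\}$, let $S$ be the scalar curvature, $\mathfrak k=\frac1{n-2}\bigl(\mathrm{Ric}-\frac{S}{2(n-1)}g\bigr)$ the Schouten tensor and $W=R-g\odot\mathfrak k$ the Weyl tensor, where $$(g\odot h)(X,Y,Z,T)=g(X,T)h(Y,Z)+g(Y,Z)h(X,T)-g(X,Z)h(Y,T)-g(Y,T)h(X,Z).$$ Put $(\mathrm d^\nabla\mathfrak k)(X,Y,Z)=(\nabla_X\mathfrak k)(Y,Z)-(\nabla_Y\mathfrak k)(X,Z)$ and $\delta W(X,Y,Z)=\sum_j(\nabla_{e_j}W)(X,Y,Z,e_j)$, $\delta W_Z(X,Y)=\delta W(X,Y,Z)$, where $e_1,\dots,e_n$ is a $g$-orthonormal basis. Let $\mathcal W$ be the endomorphism of $(0,2)$-tensors with $\mathcal W(X^*\otimes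 Y^*)(Z,T)=W(Y,Z,T,X)$, where $X^*=g(X,\cdot)$, and let $\mathfrak w(\theta)=\sum_i e_i\,\lrcorner\,\mathcal W^2(e_i^*\wedge\theta)$ for $\theta\in T_p^*M$, with $\alpha\wedge\beta=\alpha\otimes\beta-\beta\otimes\alpha$. Let $\mathfrak w^{\#}$ be the pointwise Moore–Penrose inverse of $\mathfrak w$ with respect to the inner product that $g$ induces on $T_p^*M$. Let $\mathcal E_p=\{v\in T_pM: W(v,\cdot,\cdot,\cdot)=0\}$ and let $M_{\mathcal E}$ be the set of all points at which $\dim\mathcal E_p$ is locally constant. For $n\ge4$ define the vector field $\mathbb T$ by $$g(\mathbb T,\cdot)=\frac1{n-3}\,\mathfrak w^{\#}\Bigl(\sum_i e_i\,\lrcorner\,\mathcal W(\delta W_{e_i})\Bigr)$$ and the modified Cotton tensor by $C_{\mathbb T}=\mathrm d^\nabla\mathfrak k-W(\cdot,\cdot,\cdot,\mathbb T)$; for $n=3$ put $\mathbb T=0$, so that $C_{\mathbb T}=\mathrm d^\nabla\mathfrak k$ is the Cotton tensor. Let $\phi:M\to\mathbb R$ be smooth, $\psi=e^{\phi}$ and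 $\overline g=\psi^{-2}g$, and mark the objects belonging to $\overline g$ by a bar. Then: 1. $M_{\mathcal E}$ is open and dense in $M$, and it is conformally invariant: $\overline M_{\overline{\mathcal E}}=M_{\mathcal E}$. 2. $\overline C_{\overline{\mathbb T}}=C_{\mathbb T}$ on $M_{\mathcal E}$; that is, $C_{\mathbb T}$ is a conformal invariant of weight zero. 3. If $n\ge4$, then $\overline{\mathbb T}=\psi^2\bigl(\mathbb T-(\nabla\phi)_{\mathcal E^\perp}\bigr)$ on $M_{\mathcal E}$, where $\nabla\phi$ is the $g$-gradient of $\phi$ and $(\cdot)_{\mathcal E^\perp}$ is the $g$-orthogonal projection onto the $g$-orthogonal complement of $\mathcal E_p$ in $T_pM$. -/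

import Mathlib

set_option maxSynthPendingDepth 3

open scoped Manifold ContDiff Topology

noncomputable section

namespace ConformalCotton

/-! ### Linear algebra: the Moore-Penrose inverse -/

/-- `B` is a Moore-Penrose inverse of the endomorphism `A` with respect to the inner product `h`. -/
structure IsMoorePenrose {V : Type*} [AddCommGroup V] [Module ℝ V] (h : V → V → ℝ)
    (A B : V →ₗ[ℝ] V) : Prop where
  aba : A ∘ₗ B ∘ₗ A = A
  bab : B ∘ₗ A ∘ₗ B = B
  symm_ab : ∀ v w, h (A (B v)) w = h v (A (B w))
  symm_ba : ∀ v w, h (B (A v)) w = h v (B (A w))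

open Classical in
/-- The Moore-Penrose inverse of `A` with respect to `h` (it exists and is unique when `V` is finite
dimensional and `h` is an inner product). -/
def moorePenrose {V : Type*} [AddCommGroup V] [Module ℝ V] (h : V → V → ℝ)
    (A : V →ₗ[ℝ] V) : V →ₗ[ℝ] V :=
  if H : ∃ B, IsMoorePenrose h A B then H.choose else 0

/-! ### Riemannian geometry of a metric `G` on an open piece of `ℝⁿ`

Here `G : ℝⁿ → (ℝⁿ →L[ℝ] ℝⁿ →L[ℝ] ℝ)` is the expression of a metric in a chart, all tensors are
evaluated on vectors of `ℝⁿ`, identified with the constant coordinate fields. Traces with respect to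
the metric are taken with the coordinate basis `eᵢ` and the reciprocal basis `eⁱ = ∑ⱼ gⁱʲ eⱼ`;
for every bilinear `b` the sum `∑ᵢ b(eᵢ, eⁱ)` is the sum `∑ᵢ b(εᵢ, εᵢ)` over any orthonormal
basis. -/

/-- The coordinate space `ℝⁿ`. -/
abbrev Eu (n : ℕ) : Type := EuclideanSpace ℝ (Fin n)

/-- The type of families of bilinear forms on `ℝⁿ`. -/
abbrev LocalMetric (n : ℕ) : Type := Eu n → (Eu n →L[ℝ] Eu n →L[ℝ] ℝ)

namespace Loc

variable {n : ℕ} (G : LocalMetric n) (x : Eu n)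

/-- The coordinate basis vector `eᵢ`. -/
def e (i : Fin n) : Eu n := EuclideanSpace.single i 1

/-- The `i`-th coordinate covector, dual to the basis `e`. -/
def eps (i : Fin n) : Eu n →L[ℝ] ℝ := EuclideanSpace.proj i

/-- Raising an index: the vector `v` with `G x v w = θ w` for all `w`. -/
def sharp (θ : Eu n →L[ℝ] ℝ) : Eu n := (G x).inverse θ

/-- The reciprocal basis `eⁱ`, with `G(eⁱ, eⱼ) = δᵢⱼ`. -/
def eUp (i : Fin n) : Eu n := sharp G x (eps i)

/-- The form `(u, v, w) ↦ ∂ᵤ G(v, w) + ∂ᵥ G(u, w) - ∂_w G(u, v)`. -/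
def koszul : Eu n →L[ℝ] Eu n →L[ℝ] Eu n →L[ℝ] ℝ :=
  fderiv ℝ G x + (fderiv ℝ G x).flip
    - ContinuousLinearMap.comp
        ((ContinuousLinearMap.flipₗᵢ ℝ (Eu n) (Eu n) ℝ).toContinuousLinearEquiv :
          (Eu n →L[ℝ] Eu n →L[ℝ] ℝ) →L[ℝ] (Eu n →L[ℝ] Eu n →L[ℝ] ℝ))
        (fderiv ℝ G x).flip

theorem koszul_apply (u v w : Eu n) :
    koszul G x u v w
      = fderiv ℝ G x u v w + fderiv ℝ G x v u w - fderiv ℝ G x w u v := rfl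

/-- The Christoffel symbols `Γ(u, v) = ∇ᵤ v` of the Levi-Civita connection, for constant fields:
`2 G(Γ(u, v), w) = ∂ᵤ G(v, w) + ∂ᵥ G(u, w) - ∂_w G(u, v)`. -/
def chr : Eu n →L[ℝ] Eu n →L[ℝ] Eu n :=
  (1 / 2 : ℝ) •
    (ContinuousLinearMap.compL ℝ (Eu n) (Eu n →L[ℝ] ℝ) (Eu n) (G x).inverse ∘L koszul G x)

theorem chr_apply (u v : Eu n) : chr G x u v = (1 / 2 : ℝ) • sharp G x (koszul G x u v) := rfl

/-- The curvature operator `R_{u,v} w = ∇ᵤ ∇ᵥ w - ∇ᵥ ∇ᵤ w`. -/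
def curv (u v w : Eu n) : Eu n :=
  fderiv ℝ (chr G) x u v w - fderiv ℝ (chr G) x v u w
    + chr G x u (chr G x v w) - chr G x v (chr G x u w)

/-- The Riemannian curvature tensor `R(u, v, w, z) = g(R_{u,v} w, z)`. -/
def riem (u v w z : Eu n) : ℝ := G x (curv G x u v w) z

/-- `Ric(u, v)` is the trace of `z ↦ R_{z,u} v`. -/
def ric (u v : Eu n) : ℝ := ∑ i, eps i (curv G x (e i) u v)

/-- The scalar curvature. -/
def scal : ℝ := ∑ i, ric G x (e i) (eUp G x i)

/-- The Schouten tensor `𝔨`. -/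
def schouten (u v : Eu n) : ℝ :=
  1 / ((n : ℝ) - 2) * (ric G x u v - 1 / (2 * ((n : ℝ) - 1)) * scal G x * G x u v)

/-- The Kulkarni-Nomizu product of `2`-tensors. -/
def kulkarniNomizu (a b : Eu n → Eu n → ℝ) (u v w z : Eu n) : ℝ :=
  a u z * b v w + a v w * b u z - a u w * b v z - a v z * b u w

/-- The Weyl tensor `W = R - g ⊙ 𝔨`. -/
def weyl (u v w z : Eu n) : ℝ :=
  riem G x u v w z - kulkarniNomizu (fun a b => G x a b) (schouten G x) u v w z

/-- The covariant derivative `(∇ᵤ 𝔨)(v, w)` of the Schouten tensor. -/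
def nablaSchouten (u v w : Eu n) : ℝ :=
  fderiv ℝ (fun y => schouten G y v w) x u
    - schouten G x (chr G x u v) w - schouten G x v (chr G x u w)

/-- The exterior derivative `d^∇ 𝔨 (u, v, w) = (∇ᵤ 𝔨)(v, w) - (∇ᵥ 𝔨)(u, w)`. -/
def dSchouten (u v w : Eu n) : ℝ := nablaSchouten G x u v w - nablaSchouten G x v u w

/-- The covariant derivative `(∇ᵤ W)(a, b, c, d)` of the Weyl tensor. -/
def nablaWeyl (u a b c d : Eu n) : ℝ :=
  fderiv ℝ (fun y => weyl G y a b c d) x u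
    - weyl G x (chr G x u a) b c d - weyl G x a (chr G x u b) c d
    - weyl G x a b (chr G x u c) d - weyl G x a b c (chr G x u d)

/-- The divergence `δW` (in the fourth argument) of the Weyl tensor. -/
def divWeyl (a b c : Eu n) : ℝ := ∑ j, nablaWeyl G x (e j) a b c (eUp G x j)

/-- The Weyl tensor as an endomorphism of `2`-tensors,
`u* ⊗ v* ↦ ((z, t) ↦ W(v, z, t, u))`. -/
def weylOp (b : Eu n → Eu n → ℝ) (z t : Eu n) : ℝ :=
  ∑ i, ∑ j, b (eUp G x i) (eUp G x j) * weyl G x (e j) z t (e i)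

/-- `α ∧ β = α ⊗ β - β ⊗ α`. -/
def wedge (α β : Eu n →L[ℝ] ℝ) (u v : Eu n) : ℝ := α u * β v - β u * α v

/-- The linear form with the components `f (e k)`; it is `f` itself if `f` is linear. -/
def covec (f : Eu n → ℝ) : Eu n →L[ℝ] ℝ := ∑ k, f (e k) • eps k

/-- The negative Ricci contraction of the square of the Weyl operator,
`𝔴(θ) = ∑ᵢ eᵢ ⌟ 𝒲²(εᵢ ∧ θ)`, an endomorphism of the space of covectors. -/
def frakw : (Eu n →L[ℝ] ℝ) →ₗ[ℝ] (Eu n →L[ℝ] ℝ) where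
  toFun θ := covec fun z => ∑ i, weylOp G x (weylOp G x (wedge (eps i) θ)) (e i) z
  map_add' θ η := by
    simp only [covec, ← Finset.sum_add_distrib, ← add_smul]
    refine Finset.sum_congr rfl fun k _ => congrArg (· • eps k) <|
      Finset.sum_congr rfl fun i _ => ?_
    simp only [weylOp, wedge, add_apply, ← Finset.sum_add_distrib, ← add_mul]
    refine Finset.sum_congr rfl fun a _ => Finset.sum_congr rfl fun b _ => ?_
    congr 1
    refine Finset.sum_congr rfl fun c _ => Finset.sum_congr rfl fun d _ => ?_
    ring
  map_smul' r θ := by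
    simp only [covec, Finset.smul_sum, smul_smul, RingHom.id_apply]
    refine Finset.sum_congr rfl fun k _ => congrArg (· • eps k) ?_
    simp only [weylOp, wedge, smul_apply, smul_eq_mul, Finset.mul_sum,
      Finset.sum_mul]
    refine Finset.sum_congr rfl fun i _ => Finset.sum_congr rfl fun a _ =>
      Finset.sum_congr rfl fun b _ => Finset.sum_congr rfl fun c _ =>
      Finset.sum_congr rfl fun d _ => ?_
    ring

/-- The inner product of covectors induced by the metric. -/
def coInner (α β : Eu n →L[ℝ] ℝ) : ℝ := α (sharp G x β)

/-- The one form `∑ᵢ εᵢ ⌟ 𝒲(δW_{εᵢ})`, for any orthonormal basis `εᵢ`, where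
`δW_c(a, b) = δW(a, b, c)`. -/
def divForm : Eu n →L[ℝ] ℝ :=
  covec fun z => ∑ i, weylOp G x (fun a b => divWeyl G x a b (e i)) (eUp G x i) z

/-- The vector field `𝕋`,
`g(𝕋, ·) = (n - 3)⁻¹ 𝔴^#(∑ᵢ εᵢ ⌟ 𝒲(δW_{εᵢ}))` (and `0` if `n = 3`). -/
def fieldT : Eu n :=
  sharp G x ((1 / ((n : ℝ) - 3)) • moorePenrose (coInner G x) (frakw G x) (divForm G x))

theorem curv_add (u u' v w : Eu n) :
    curv G x (u + u') v w = curv G x u v w + curv G x u' v w := by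
  simp only [curv, map_add, add_apply]; abel

theorem curv_smul (r : ℝ) (u v w : Eu n) : curv G x (r • u) v w = r • curv G x u v w := by
  simp only [curv, map_smul, smul_apply, smul_sub, smul_add]

theorem curv_add_mid (u v v' w : Eu n) :
    curv G x u (v + v') w = curv G x u v w + curv G x u v' w := by
  simp only [curv, map_add, add_apply]; abel

theorem curv_smul_mid (r : ℝ) (u v w : Eu n) : curv G x u (r • v) w = r • curv G x u v w := by
  simp only [curv, map_smul, smul_apply, smul_sub, smul_add]

theorem schouten_add (u u' v : Eu n) :
    schouten G x (u + u') v = schouten G x u v + schouten G x u' v := by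
  simp only [schouten, ric, curv_add_mid, map_add, add_apply,
    Finset.sum_add_distrib]
  ring

theorem schouten_smul (r : ℝ) (u v : Eu n) :
    schouten G x (r • u) v = r * schouten G x u v := by
  simp only [schouten, ric, curv_smul_mid, map_smul, smul_apply,
    smul_eq_mul, ← Finset.mul_sum]
  ring

theorem weyl_add (u u' v w z : Eu n) :
    weyl G x (u + u') v w z = weyl G x u v w z + weyl G x u' v w z := by
  simp only [weyl, riem, kulkarniNomizu, curv_add, schouten_add, map_add,
    add_apply]
  ring

theorem weyl_smul (r : ℝ) (u v w z : Eu n) :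
    weyl G x (r • u) v w z = r * weyl G x u v w z := by
  simp only [weyl, riem, kulkarniNomizu, curv_smul, schouten_smul, map_smul,
    smul_apply, smul_eq_mul]
  ring

end Loc

/-! ### Riemannian manifolds -/

/-- Smooth Riemannian metrics on the `n`-dimensional manifold `M`. -/
abbrev RiemMetric (n : ℕ) (M : Type*) [TopologicalSpace M] [ChartedSpace (Eu n) M]
    [IsManifold 𝓘(ℝ, Eu n) ∞ M] : Type _ :=
  Bundle.ContMDiffRiemannianMetric 𝓘(ℝ, Eu n) ∞ (Eu n) (fun p : M => TangentSpace 𝓘(ℝ, Eu n) p)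

variable {n : ℕ} {M : Type*} [TopologicalSpace M] [ChartedSpace (Eu n) M]
  [IsManifold 𝓘(ℝ, Eu n) ∞ M]

/-- The expression of the metric `g` in the preferred chart around `p`. -/
def localMetric (g : RiemMetric n M) (p : M) : LocalMetric n := fun x =>
  let D : Eu n →L[ℝ] TangentSpace 𝓘(ℝ, Eu n) ((extChartAt 𝓘(ℝ, Eu n) p).symm x) :=
    mfderiv 𝓘(ℝ, Eu n) 𝓘(ℝ, Eu n) (extChartAt 𝓘(ℝ, Eu n) p).symm x
  (ContinuousLinearMap.compL ℝ (Eu n) (Eu n) ℝ).flip D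
    ∘L ((g.inner ((extChartAt 𝓘(ℝ, Eu n) p).symm x)) ∘L D)

/-- The point `p` in its preferred chart. -/
def pt (n : ℕ) {M : Type*} [TopologicalSpace M] [ChartedSpace (Eu n) M] (p : M) : Eu n :=
  extChartAt 𝓘(ℝ, Eu n) p p

/-- The components of a tangent vector at `p` with respect to the preferred chart around `p`. -/
def coord (p : M) : TangentSpace 𝓘(ℝ, Eu n) p →L[ℝ] Eu n :=
  mfderiv 𝓘(ℝ, Eu n) 𝓘(ℝ, Eu n) (extChartAt 𝓘(ℝ, Eu n) p) p

/-- The Weyl tensor of `g`. -/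
def weyl (g : RiemMetric n M) (p : M) (a b c d : TangentSpace 𝓘(ℝ, Eu n) p) : ℝ :=
  Loc.weyl (localMetric g p) (pt n p) (coord p a) (coord p b) (coord p c) (coord p d)

/-- The exterior derivative `d^∇ 𝔨` of the Schouten tensor of `g`. -/
def dSchouten (g : RiemMetric n M) (p : M) (a b c : TangentSpace 𝓘(ℝ, Eu n) p) : ℝ :=
  Loc.dSchouten (localMetric g p) (pt n p) (coord p a) (coord p b) (coord p c)

/-- The vector field `𝕋` of `g`. -/
def fieldT (g : RiemMetric n M) (p : M) : TangentSpace 𝓘(ℝ, Eu n) p :=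
  mfderiv 𝓘(ℝ, Eu n) 𝓘(ℝ, Eu n) (extChartAt 𝓘(ℝ, Eu n) p).symm (pt n p)
    (Loc.fieldT (localMetric g p) (pt n p))

/-- The modified Cotton tensor `C_𝕋 = d^∇ 𝔨 - W(·, ·, ·, 𝕋)`; it is the Cotton tensor `d^∇ 𝔨` if
`n = 3`. -/
def modCotton (g : RiemMetric n M) (p : M) (a b c : TangentSpace 𝓘(ℝ, Eu n) p) : ℝ :=
  dSchouten g p a b c - weyl g p a b c (fieldT g p)

/-- The space `𝓔_p = {v | W(v, ·, ·, ·) = 0}`. -/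
def nullity (g : RiemMetric n M) (p : M) : Submodule ℝ (TangentSpace 𝓘(ℝ, Eu n) p) where
  carrier := {v | ∀ a b c, weyl g p v a b c = 0}
  add_mem' {v w} hv hw a b c := by
    have h1 := hv a b c
    have h2 := hw a b c
    simp only [weyl] at h1 h2 ⊢
    rw [map_add, Loc.weyl_add, h1, h2, add_zero]
  zero_mem' a b c := by
    have := Loc.weyl_smul (localMetric g p) (pt n p) 0 0 (coord p a) (coord p b) (coord p c)
    simpa [weyl] using this
  smul_mem' r v hv a b c := by
    have h1 := hv a b c
    simp only [weyl] at h1 ⊢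
    rw [map_smul, Loc.weyl_smul, h1, mul_zero]

/-- The set `M_𝓔` of all points at which the rank of `𝓔` is locally constant. -/
def constRankSet (g : RiemMetric n M) : Set M :=
  {p | ∀ᶠ q in 𝓝 p, Module.finrank ℝ (nullity g q) = Module.finrank ℝ (nullity g p)}

/-- The metric at `p` as a bilinear form. -/
def bilin (g : RiemMetric n M) (p : M) : LinearMap.BilinForm ℝ (TangentSpace 𝓘(ℝ, Eu n) p) :=
  LinearMap.mk₂ ℝ (fun v w => g.inner p v w)
    (by intros; simp) (by intros; simp) (by intros; simp) (by intros; simp)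

/-- The orthogonal complement `𝓔_p^⊥` of `𝓔_p` with respect to `g`. -/
def perp (g : RiemMetric n M) (p : M) : Submodule ℝ (TangentSpace 𝓘(ℝ, Eu n) p) :=
  (bilin g p).orthogonal (nullity g p)

theorem isCompl_perp (g : RiemMetric n M) (p : M) : IsCompl (perp g p) (nullity g p) := by
  have : FiniteDimensional ℝ (TangentSpace 𝓘(ℝ, Eu n) p) :=
    inferInstanceAs (FiniteDimensional ℝ (Eu n))
  have hrefl : (bilin g p).IsRefl := fun v w h => by
    have := g.symm p v w
    simp only [bilin, LinearMap.mk₂_apply] at h ⊢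
    rw [← this, h]
  refine ((LinearMap.BilinForm.isCompl_orthogonal_iff_disjoint hrefl).2 ?_).symm
  rw [Submodule.disjoint_def]
  intro v hv hv'
  by_contra hne
  have h1 := g.pos p v hne
  have h2 : g.inner p v v = 0 := hv' v hv
  exact h1.ne' h2

/-- The `g`-orthogonal projection `v ↦ v_{𝓔^⊥}` of `T_p M` onto `𝓔_p^⊥`. -/
def perpPart (g : RiemMetric n M) (p : M) (v : TangentSpace 𝓘(ℝ, Eu n) p) :
    TangentSpace 𝓘(ℝ, Eu n) p :=
  (perp g p).projection (nullity g p) (isCompl_perp g p) v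

/-- The gradient of `φ` with respect to `g`, the vector field with `g(∇φ, ·) = dφ`. -/
def grad (g : RiemMetric n M) (φ : M → ℝ) (p : M) : TangentSpace 𝓘(ℝ, Eu n) p :=
  (g.inner p).inverse (mfderiv 𝓘(ℝ, Eu n) 𝓘(ℝ, ℝ) φ p)

end ConformalCotton

end

noncomputable section

namespace ConformalCotton

namespace Loc

variable {n : ℕ} {G : LocalMetric n} {U : Set (Eu n)} {x : Eu n}

/-! Everything is computed in a chart, where the second metric is `exp (-2 φ) G`. Inserting the
change of the Christoffel symbols into the curvature gives R̄ = e^{-2φ}(R + g ⊙ A) with A = Hess φ +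
dφ ⊗ dφ - ½|dφ|² g (`IsConformalOn.curv_eq`, `IsConformalOn.riem_eq`). The Schouten tensor is
normalised so that it changes by exactly A (`IsConformalOn.schouten_eq`), hence W̄ = e^{-2φ} W. One
more derivative shows that d^∇𝔨 changes by -W(·,·,·,∇φ) and δW by -(n-3) W(·,·,·,∇φ)
(`IsConformalOn.dSchouten_eq`, `IsConformalOn.divWeyl_eq`).

The field 𝕋 is built to absorb ∇φ. Up to the factor e^{4φ}, the one form to which 𝔴^# is applied
changes by -(n-3) 𝔴(dφ). By the symmetries of W, twice 𝔴 is the Gram form of θ ↦ W(·,·,·,θ^♯)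
(`IsMetricOn.frakw_apply_frame`). So 𝔴 is self-adjoint with kernel dual to 𝓔, and 𝔴^# 𝔴 is the
orthogonal projection onto the dual of 𝓔^⊥. With the scaling of 𝔴^# this yields 𝕋̄ = ψ²(𝕋 -
(∇φ)_{𝓔^⊥}) (`IsConformalOn.fieldT_eq`). Since W ignores the 𝓔-component of ∇φ, the corrections of
d^∇𝔨 and of W(·,·,·,𝕋) cancel in C_𝕋; for n = 3 the Weyl tensor vanishes.

For M_𝓔, dim 𝓔 is the nullity of a continuous family of linear maps, hence upper semicontinuous. A
point minimising it over a nonempty open set therefore lies in M_𝓔, which gives density. The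
definitions read every point in its own preferred chart, so comparing neighbouring points requires
that W is natural under transition maps (`IsIsometryOn.weyl_eq`). -/

/-- `G` is a smooth Riemannian metric on the open set `U`. -/
structure IsMetricOn (G : LocalMetric n) (U : Set (Eu n)) : Prop where
  isOpen : IsOpen U
  contDiffAt : ∀ y ∈ U, ContDiffAt ℝ ∞ G y
  symm : ∀ y ∈ U, ∀ v w, G y v w = G y w v
  pos : ∀ y ∈ U, ∀ v, v ≠ 0 → 0 < G y v v

/-! ### Derivatives of operator valued functions -/

section Deriv

variable {E A B C D : Type*} [NormedAddCommGroup E] [NormedSpace ℝ E]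
  [NormedAddCommGroup A] [NormedSpace ℝ A] [NormedAddCommGroup B] [NormedSpace ℝ B]
  [NormedAddCommGroup C] [NormedSpace ℝ C] [NormedAddCommGroup D] [NormedSpace ℝ D]

theorem fderiv_apply_const {f : E → A →L[ℝ] B} {x : E} (hf : DifferentiableAt ℝ f x) (v : A)
    (u : E) : fderiv ℝ (fun y => f y v) x u = fderiv ℝ f x u v := by
  rw [fderiv_clm_apply hf (differentiableAt_const v)]
  simp

theorem fderiv_apply_const₂ {f : E → A →L[ℝ] B →L[ℝ] C} {x : E} (hf : DifferentiableAt ℝ f x)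
    (v : A) (w : B) (u : E) : fderiv ℝ (fun y => f y v w) x u = fderiv ℝ f x u v w := by
  rw [fderiv_apply_const (hf.clm_apply (differentiableAt_const v)), fderiv_apply_const hf]

theorem fderiv_apply_const₃ {f : E → A →L[ℝ] B →L[ℝ] C →L[ℝ] D} {x : E}
    (hf : DifferentiableAt ℝ f x) (a : A) (v : B) (w : C) (u : E) :
    fderiv ℝ (fun y => f y a v w) x u = fderiv ℝ f x u a v w := by
  rw [fderiv_apply_const₂ (hf.clm_apply (differentiableAt_const a)), fderiv_apply_const hf]

theorem fderiv_apply_fun {f : E → A →L[ℝ] B} {g : E → A} {x : E} (hf : DifferentiableAt ℝ f x)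
    (hg : DifferentiableAt ℝ g x) (u : E) :
    fderiv ℝ (fun y => f y (g y)) x u = fderiv ℝ f x u (g x) + f x (fderiv ℝ g x u) := by
  rw [fderiv_clm_apply hf hg]
  simp [add_comm]

theorem fderiv_apply_fun₂ {f : E → A →L[ℝ] B →L[ℝ] C} {g : E → A} {h : E → B} {x : E}
    (hf : DifferentiableAt ℝ f x) (hg : DifferentiableAt ℝ g x) (hh : DifferentiableAt ℝ h x)
    (u : E) :
    fderiv ℝ (fun y => f y (g y) (h y)) x u
      = fderiv ℝ f x u (g x) (h x) + f x (fderiv ℝ g x u) (h x) + f x (g x) (fderiv ℝ h x u) := by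
  rw [fderiv_apply_fun (hf.clm_apply hg) hh, fderiv_apply_fun hf hg, add_apply]

theorem fderiv_fderiv_comm {f : E → A} {x : E} (hf : ContDiffAt ℝ ∞ f x) (u v : E) :
    fderiv ℝ (fderiv ℝ f) x u v = fderiv ℝ (fderiv ℝ f) x v u :=
  (hf.isSymmSndFDerivAt (by
    rw [minSmoothness_of_isRCLikeNormedField]
    exact WithTop.coe_le_coe.2 (le_top : (2 : ℕ∞) ≤ ⊤))).eq u v

theorem contDiffAt_fderiv {f : E → A} {x : E} (hf : ContDiffAt ℝ ∞ f x) :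
    ContDiffAt ℝ ∞ (fderiv ℝ f) x :=
  hf.fderiv_right (by simp)

end Deriv

/-- Definiteness gives injectivity, and equality of dimensions does the rest.
`ContinuousLinearMap.inverse` is zero on non-invertible maps, so this is what gives `sharp` its
meaning. -/
theorem isInvertible_of_pos {h : Eu n →L[ℝ] Eu n →L[ℝ] ℝ} (hp : ∀ v, v ≠ 0 → 0 < h v v) :
    h.IsInvertible := by
  have hinj : Function.Injective h := by
    rw [injective_iff_map_eq_zero]
    intro v hv
    by_contra hne
    have := hp v hne
    rw [hv] at this
    simp at this
  have hfr : Module.finrank ℝ (Eu n) = Module.finrank ℝ (Eu n →L[ℝ] ℝ) := by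
    rw [← (LinearMap.toContinuousLinearMap (E := Eu n) (F' := ℝ) (𝕜 := ℝ)).finrank_eq]
    exact (Subspace.dual_finrank_eq).symm
  exact ⟨(LinearEquiv.ofInjectiveOfFinrankEq (h : Eu n →ₗ[ℝ] (Eu n →L[ℝ] ℝ)) hinj
    hfr).toContinuousLinearEquiv, by ext; rfl⟩

theorem curv_swap (u v w : Eu n) : curv G x u v w = - curv G x v u w := by
  simp only [curv]; abel

/-! ### The Levi-Civita connection in coordinates and the symmetries of its curvature. -/

namespace IsMetricOn

variable (hG : IsMetricOn G U) (hx : x ∈ U)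
include hG hx

theorem mem_nhds : U ∈ 𝓝 x := hG.isOpen.mem_nhds hx

theorem isInvertible : (G x).IsInvertible := isInvertible_of_pos (hG.pos x hx)

theorem apply_sharp (θ : Eu n →L[ℝ] ℝ) : G x (sharp G x θ) = θ :=
  (hG.isInvertible hx).self_apply_inverse θ

theorem sharp_apply (v : Eu n) : sharp G x (G x v) = v :=
  (hG.isInvertible hx).inverse_apply_self v

theorem ext_left {v w : Eu n} (h : ∀ z, G x v z = G x w z) : v = w := by
  rw [← hG.sharp_apply hx v, ← hG.sharp_apply hx w]
  congr 1
  ext z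
  exact h z

theorem contDiffAt_inverse : ContDiffAt ℝ ∞ (fun y => (G y).inverse) x := by
  obtain ⟨e, he⟩ := hG.isInvertible hx
  have := contDiffAt_map_inverse (𝕜 := ℝ) (n := ∞) e
  rw [he] at this
  exact this.comp x (hG.contDiffAt x hx)

theorem contDiffAt_fderiv : ContDiffAt ℝ ∞ (fderiv ℝ G) x :=
  Loc.contDiffAt_fderiv (hG.contDiffAt x hx)

theorem contDiffAt_koszul : ContDiffAt ℝ ∞ (koszul G) x := by
  have h := hG.contDiffAt_fderiv hx
  have h2 : ContDiffAt ℝ ∞ (fun y => (fderiv ℝ G y).flip) x :=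
    ((ContinuousLinearMap.flipₗᵢ ℝ (Eu n) (Eu n)
      (Eu n →L[ℝ] ℝ)).toContinuousLinearEquiv.contDiff.contDiffAt).comp x h
  exact (h.add h2).sub (contDiffAt_const.clm_comp h2)

theorem contDiffAt_chr : ContDiffAt ℝ ∞ (chr G) x := by
  have h1 : ContDiffAt ℝ ∞ (fun y => ContinuousLinearMap.compL ℝ (Eu n) (Eu n →L[ℝ] ℝ) (Eu n)
      (G y).inverse) x :=
    (ContinuousLinearMap.contDiff _).contDiffAt.comp x (hG.contDiffAt_inverse hx)
  exact (h1.clm_comp (hG.contDiffAt_koszul hx)).const_smul (1 / 2 : ℝ)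

theorem fderiv_symm (u v w : Eu n) : fderiv ℝ G x u v w = fderiv ℝ G x u w v := by
  have hd := (hG.contDiffAt x hx).differentiableAt (by simp)
  rw [← fderiv_apply_const₂ hd, ← fderiv_apply_const₂ hd]
  congr 1
  apply Filter.EventuallyEq.fderiv_eq
  filter_upwards [hG.mem_nhds hx] with y hy using hG.symm y hy v w

theorem two_mul_chr (u v w : Eu n) :
    2 * G x (chr G x u v) w = fderiv ℝ G x u v w + fderiv ℝ G x v u w - fderiv ℝ G x w u v := by
  rw [chr_apply, map_smul, hG.apply_sharp hx, smul_apply, koszul_apply, smul_eq_mul]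
  ring

theorem chr_comm (u v : Eu n) : chr G x u v = chr G x v u := by
  refine hG.ext_left hx fun z => ?_
  have h1 := hG.two_mul_chr hx u v z
  have h2 := hG.two_mul_chr hx v u z
  have h3 := hG.fderiv_symm hx z u v
  linarith

/-- The Levi-Civita connection is metric. -/
theorem fderiv_eq (u v w : Eu n) :
    fderiv ℝ G x u v w = G x (chr G x u v) w + G x v (chr G x u w) := by
  have h1 := hG.two_mul_chr hx u v w
  have h2 := hG.two_mul_chr hx u w v
  have h3 := hG.fderiv_symm hx v u w
  have h4 := hG.fderiv_symm hx w u v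
  have h5 := hG.fderiv_symm hx u v w
  rw [hG.symm x hx v]
  linarith

theorem differentiableAt : DifferentiableAt ℝ G x :=
  (hG.contDiffAt x hx).differentiableAt (by simp)

theorem differentiableAt_chr : DifferentiableAt ℝ (chr G) x :=
  (hG.contDiffAt_chr hx).differentiableAt (by simp)

theorem fderiv_chr_comm (u v w : Eu n) :
    fderiv ℝ (chr G) x u v w = fderiv ℝ (chr G) x u w v := by
  have hd := hG.differentiableAt_chr hx
  rw [← fderiv_apply_const₂ hd, ← fderiv_apply_const₂ hd]
  congr 1
  apply Filter.EventuallyEq.fderiv_eq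
  filter_upwards [hG.mem_nhds hx] with y hy using hG.chr_comm hy v w

/-- Metric compatibility, differentiated once more. Skew-symmetrised in `u`, `v`, the left side
vanishes and the mixed terms G(Γ, Γ) cancel; what is left is the skew-symmetry of the curvature in
its last two slots. -/
theorem fderiv_fderiv (u v a b : Eu n) :
    fderiv ℝ (fderiv ℝ G) x u v a b
      = G x (fderiv ℝ (chr G) x u v a) b + G x a (fderiv ℝ (chr G) x u v b)
        + G x (chr G x u (chr G x v a)) b + G x (chr G x v a) (chr G x u b)
        + G x (chr G x u a) (chr G x v b) + G x a (chr G x u (chr G x v b)) := by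
  have hc := hG.differentiableAt_chr hx
  have hd := hG.differentiableAt hx
  have hdd := (hG.contDiffAt_fderiv hx).differentiableAt (by simp)
  rw [← fderiv_apply_const₃ hdd]
  have hE : (fun y => fderiv ℝ G y v a b)
      =ᶠ[𝓝 x] fun y => G y (chr G y v a) b + G y a (chr G y v b) := by
    filter_upwards [hG.mem_nhds hx] with y hy using hG.fderiv_eq hy v a b
  have hca : ∀ a : Eu n, DifferentiableAt ℝ (fun y => chr G y v a) x := fun a =>
    (hc.clm_apply (differentiableAt_const v)).clm_apply (differentiableAt_const a)
  rw [hE.fderiv_eq, fderiv_fun_add ((hd.clm_apply (hca a)).clm_apply (differentiableAt_const b))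
    ((hd.clm_apply (differentiableAt_const a)).clm_apply (hca b)), add_apply,
    fderiv_apply_fun₂ hd (hca a) (differentiableAt_const b),
    fderiv_apply_fun₂ hd (differentiableAt_const a) (hca b),
    fderiv_apply_const₂ hc, fderiv_apply_const₂ hc, hG.fderiv_eq hx, hG.fderiv_eq hx]
  simp only [fderiv_fun_const, Pi.zero_apply, zero_apply, map_zero]
  ring

/-- The connection is torsion free at every nearby point, so both Γ and its derivative are symmetric
and the cyclic sum cancels in pairs. -/
theorem curv_bianchi (u v w : Eu n) :
    curv G x u v w + curv G x v w u + curv G x w u v = 0 := by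
  simp only [curv, hG.fderiv_chr_comm hx u v w, hG.fderiv_chr_comm hx v w u,
    hG.fderiv_chr_comm hx w u v, hG.chr_comm hx v w, hG.chr_comm hx w u, hG.chr_comm hx v u]
  abel

theorem riem_swap₃₄ (u v w z : Eu n) : riem G x u v w z = - riem G x u v z w := by
  have h1 := hG.fderiv_fderiv hx u v w z
  have h2 := hG.fderiv_fderiv hx v u w z
  have h3 := congrArg (fun f => f w z) (fderiv_fderiv_comm (hG.contDiffAt x hx) u v)
  simp only [riem, curv, map_add, map_sub, add_apply, sub_apply]
  rw [hG.symm x hx w, hG.symm x hx w] at h1 h2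
  linarith

end IsMetricOn

theorem riem_swap₁₂ (u v w z : Eu n) : riem G x u v w z = - riem G x v u w z := by
  simp [riem, curv_swap u v w]

/-! ### Multilinearity, symmetries and contractions -/

theorem curv_add_right (u v w w' : Eu n) :
    curv G x u v (w + w') = curv G x u v w + curv G x u v w' := by
  simp only [curv, map_add]; abel

theorem curv_smul_right (r : ℝ) (u v w : Eu n) :
    curv G x u v (r • w) = r • curv G x u v w := by
  simp only [curv, map_smul, smul_sub, smul_add]

/-- A bilinear form, given as a function of two arguments. -/
structure IsBilin (B : Eu n → Eu n → ℝ) : Prop where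
  left : ∀ w, IsLinearMap ℝ fun v => B v w
  right : ∀ v, IsLinearMap ℝ (B v)

theorem eps_apply (i : Fin n) (v : Eu n) : eps i v = v i := rfl

theorem sum_eps_smul_e (v : Eu n) : ∑ i, eps i v • e i = v := by
  ext k
  simp [eps_apply, e, Pi.single_apply]

theorem sum_mul_isLinearMap {ι : Type*} {l : Eu n → ℝ} (hl : IsLinearMap ℝ l) (s : Finset ι)
    (c : ι → ℝ) (f : ι → Eu n) : ∑ i ∈ s, c i * l (f i) = l (∑ i ∈ s, c i • f i) := by
  have := map_sum hl.mk' (fun i => c i • f i) s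
  simp only [IsLinearMap.mk'_apply] at this
  rw [this]
  exact Finset.sum_congr rfl fun i _ => (hl.map_smul _ _).symm

theorem sum_eps_mul {l : Eu n → ℝ} (hl : IsLinearMap ℝ l) (v : Eu n) :
    ∑ i, eps i v * l (e i) = l v := by
  rw [sum_mul_isLinearMap hl, sum_eps_smul_e]

theorem covec_apply {f : Eu n → ℝ} (hf : IsLinearMap ℝ f) (v : Eu n) : covec f v = f v := by
  rw [← sum_eps_mul hf v]
  simp [covec, mul_comm]

theorem _root_.IsLinearMap.sum_fun {ι : Type*} {s : Finset ι} {f : ι → Eu n → ℝ}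
    (hf : ∀ i ∈ s, IsLinearMap ℝ (f i)) : IsLinearMap ℝ fun v => ∑ i ∈ s, f i v where
  map_add v w := by
    rw [← Finset.sum_add_distrib]
    exact Finset.sum_congr rfl fun i hi => (hf i hi).map_add v w
  map_smul r v := by
    rw [Finset.smul_sum]
    exact Finset.sum_congr rfl fun i hi => (hf i hi).map_smul r v

theorem _root_.IsLinearMap.const_mul_fun {f : Eu n → ℝ} (hf : IsLinearMap ℝ f) (c : ℝ) :
    IsLinearMap ℝ fun v => c * f v where
  map_add v w := by rw [hf.map_add, mul_add]
  map_smul r v := by simp only [hf.map_smul, smul_eq_mul]; ring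

theorem _root_.IsLinearMap.mul_const_fun {f : Eu n → ℝ} (hf : IsLinearMap ℝ f) (c : ℝ) :
    IsLinearMap ℝ fun v => f v * c where
  map_add v w := by rw [hf.map_add, add_mul]
  map_smul r v := by simp only [hf.map_smul, smul_eq_mul]; ring

theorem _root_.IsLinearMap.neg_fun {f : Eu n → ℝ} (hf : IsLinearMap ℝ f) :
    IsLinearMap ℝ fun v => - f v where
  map_add v w := by rw [hf.map_add, neg_add]
  map_smul r v := by simp only [hf.map_smul, smul_eq_mul]; ring

theorem _root_.IsLinearMap.sub_fun {f g : Eu n → ℝ} (hf : IsLinearMap ℝ f)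
    (hg : IsLinearMap ℝ g) : IsLinearMap ℝ fun v => f v - g v where
  map_add v w := by rw [hf.map_add, hg.map_add]; ring
  map_smul r v := by simp only [hf.map_smul, hg.map_smul, smul_eq_mul]; ring

/-! ### Orthonormal frames and metric contractions. -/

/-- A family of vectors which is orthonormal for the form `h` and spans. -/
structure IsFrame (h : Eu n →L[ℝ] Eu n →L[ℝ] ℝ) (f : Fin n → Eu n) : Prop where
  ortho : ∀ i j, h (f i) (f j) = if i = j then 1 else 0
  expand : ∀ v, ∑ i, h v (f i) • f i = v

/-- An orthogonal basis of a symmetric form, normalised by positivity. In the expansion, the error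
is orthogonal to a basis and hence to itself. -/
theorem exists_isFrame {h : Eu n →L[ℝ] Eu n →L[ℝ] ℝ} (hs : ∀ v w, h v w = h w v)
    (hp : ∀ v, v ≠ 0 → 0 < h v v) : ∃ f, IsFrame h f := by
  let B : LinearMap.BilinForm ℝ (Eu n) :=
    LinearMap.mk₂ ℝ (fun v w => h v w) (by simp) (by simp) (by simp) (by simp)
  have hB : ∀ v w, B v w = h v w := fun v w => rfl
  obtain ⟨b, hb⟩ := LinearMap.BilinForm.exists_orthogonal_basis (B := B)
    ⟨fun v w => hs v w⟩
  have hcard : Module.finrank ℝ (Eu n) = n := finrank_euclideanSpace_fin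
  let c := b.reindex (finCongr hcard)
  have hc : ∀ i j, i ≠ j → h (c i) (c j) = 0 := fun i j hij => by
    have := hb (i := (finCongr hcard).symm i) (j := (finCongr hcard).symm j) (by simpa using hij)
    change B _ _ = 0 at this
    simpa [c, hB] using this
  have hpc : ∀ i, 0 < h (c i) (c i) := fun i => hp _ (c.ne_zero i)
  let f : Fin n → Eu n := fun i => (√(h (c i) (c i)))⁻¹ • c i
  have hf : ∀ i j, h (f i) (f j) = if i = j then 1 else 0 := by
    intro i j
    simp only [f, map_smul, smul_apply, smul_eq_mul]
    split_ifs with hij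
    · subst hij
      have := Real.sq_sqrt (hpc i).le
      have h0 := (Real.sqrt_pos.2 (hpc i)).ne'
      field_simp
      rw [this]
    · rw [hc i j hij]; simp
  refine ⟨f, hf, fun v => ?_⟩
  have key : ∀ j, h (∑ i, h v (f i) • f i) (f j) = h v (f j) := fun j => by
    simp [hf]
  have key2 : ∀ j, h (∑ i, h v (f i) • f i - v) (c j) = 0 := fun j => by
    have h0 := (Real.sqrt_pos.2 (hpc j)).ne'
    have hcj : c j = √(h (c j) (c j)) • f j := by
      simp only [f]; rw [smul_smul, mul_inv_cancel₀ h0, one_smul]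
    rw [hcj, map_smul, map_sub, sub_apply, key j, sub_self, smul_zero]
  have key3 : h (∑ i, h v (f i) • f i - v) = 0 := by
    have : (h (∑ i, h v (f i) • f i - v) : Eu n →ₗ[ℝ] ℝ) = 0 := c.ext fun j => by
      simpa using key2 j
    ext w
    exact congrArg (fun l => l w) this
  by_contra hne
  have := hp _ (sub_ne_zero.2 hne)
  rw [key3] at this
  simp at this

namespace IsMetricOn

variable (hG : IsMetricOn G U) (hx : x ∈ U)
include hG hx

theorem apply_eUp (i : Fin n) (v : Eu n) : G x (eUp G x i) v = eps i v := by
  rw [eUp, hG.apply_sharp hx]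

theorem apply_eUp' (i : Fin n) (v : Eu n) : G x v (eUp G x i) = eps i v := by
  rw [hG.symm x hx, hG.apply_eUp hx]

theorem sum_apply_smul_eUp (v : Eu n) : ∑ i, G x v (e i) • eUp G x i = v := by
  refine hG.ext_left hx fun z => ?_
  rw [map_sum, sum_apply]
  simp only [map_smul, smul_apply, smul_eq_mul, hG.apply_eUp hx]
  simp only [mul_comm (G x v _)]
  exact sum_eps_mul (G x v).toLinearMap.isLinear z

theorem sum_apply_mul {l : Eu n → ℝ} (hl : IsLinearMap ℝ l) (v : Eu n) :
    ∑ i, G x v (e i) * l (eUp G x i) = l v := by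
  rw [sum_mul_isLinearMap hl, hG.sum_apply_smul_eUp hx]

theorem sum_mul_eUp {l : Eu n → ℝ} (hl : IsLinearMap ℝ l) (θ : Eu n →L[ℝ] ℝ) :
    ∑ i, θ (e i) * l (eUp G x i) = l (sharp G x θ) := by
  rw [← hG.sum_apply_mul hx hl, hG.apply_sharp hx]

theorem sum_eUp_mul {l : Eu n → ℝ} (hl : IsLinearMap ℝ l) (θ : Eu n →L[ℝ] ℝ) :
    ∑ i, θ (eUp G x i) * l (e i) = l (sharp G x θ) := by
  rw [← sum_eps_mul hl]
  refine Finset.sum_congr rfl fun i _ => ?_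
  rw [← hG.apply_eUp hx, hG.symm x hx, hG.apply_sharp hx]

/-- Traces may be computed with an orthonormal frame. -/
theorem contract_eq {B : Eu n → Eu n → ℝ} (hB : IsBilin B) {f : Fin n → Eu n}
    (hf : IsFrame (G x) f) : ∑ i, B (e i) (eUp G x i) = ∑ i, B (f i) (f i) := by
  -- The coefficient of eⁱ along f_j is G(eⁱ, f_j) = εⁱ(f_j); summing over i then reassembles f_j in
  -- the first slot.
  have h1 : ∀ i, B (e i) (eUp G x i) = ∑ j, eps i (f j) * B (e i) (f j) := fun i => by
    rw [sum_mul_isLinearMap (hB.right _)]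
    congr 1
    rw [← hf.expand (eUp G x i)]
    simp only [hG.apply_eUp hx]
  simp only [h1]
  rw [Finset.sum_comm]
  exact Finset.sum_congr rfl fun j _ => sum_eps_mul (hB.left _) _

theorem exists_isFrame : ∃ f, IsFrame (G x) f :=
  Loc.exists_isFrame (hG.symm x hx) (hG.pos x hx)

theorem contract_comm {B : Eu n → Eu n → ℝ} (hB : IsBilin B) :
    ∑ i, B (e i) (eUp G x i) = ∑ i, B (eUp G x i) (e i) := by
  obtain ⟨f, hf⟩ := hG.exists_isFrame hx
  rw [hG.contract_eq hx hB hf]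
  exact (hG.contract_eq hx (B := fun v w => B w v) ⟨hB.right, hB.left⟩ hf).symm

/-- The classical octahedron argument: four instances of the Bianchi identity, combined through the
two skew-symmetries. -/
theorem riem_pair (u v w z : Eu n) : riem G x u v w z = riem G x w z u v := by
  have hb : ∀ a b c d, riem G x a b c d + riem G x b c a d + riem G x c a b d = 0 :=
    fun a b c d => by
      have := congrArg (fun t => G x t d) (hG.curv_bianchi hx a b c)
      simpa [riem] using this
  have h12 := fun a b c d => riem_swap₁₂ (G := G) (x := x) a b c d
  have h34 := hG.riem_swap₃₄ hx
  linarith [hb u v w z, hb v w z u, hb w z u v, hb z u v w, h34 v w u z, h34 v z w u,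
    h12 v z w u, h34 w z v u, h12 w z u v, h34 z u w v, h12 z u w v, h12 u z w v,
    h34 w u z v, h12 w u z v, h34 u v z w, h12 u v w z, h34 z v u w, h12 z v u w, h34 w u v z,
    h12 u w v z, h34 u v w z, h34 z u v w, h12 z w u v, h34 v w z u, h34 v z u w, h34 w z u v,
    h12 v z u w, h34 u w v z]

end IsMetricOn

/-! ### The Weyl tensor of a metric -/

theorem isLinearMap_curv₁ (θ : Eu n →L[ℝ] ℝ) (v w : Eu n) :
    IsLinearMap ℝ fun u => θ (curv G x u v w) :=
  ⟨fun a b => by rw [curv_add, map_add], fun r a => by rw [curv_smul, map_smul]⟩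

theorem isLinearMap_curv₂ (θ : Eu n →L[ℝ] ℝ) (u w : Eu n) :
    IsLinearMap ℝ fun v => θ (curv G x u v w) :=
  ⟨fun a b => by rw [curv_add_mid, map_add], fun r a => by rw [curv_smul_mid, map_smul]⟩

theorem isLinearMap_curv₃ (θ : Eu n →L[ℝ] ℝ) (u v : Eu n) :
    IsLinearMap ℝ fun w => θ (curv G x u v w) :=
  ⟨fun a b => by rw [curv_add_right, map_add], fun r a => by rw [curv_smul_right, map_smul]⟩

theorem isBilin_ric : IsBilin (ric G x) where
  left w := IsLinearMap.sum_fun fun i _ => isLinearMap_curv₂ (eps i) (e i) w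
  right v := IsLinearMap.sum_fun fun i _ => isLinearMap_curv₃ (eps i) (e i) v

theorem isBilin_clm (h : Eu n →L[ℝ] Eu n →L[ℝ] ℝ) : IsBilin fun v w => h v w where
  left w := ⟨fun a b => by simp, fun r a => by simp⟩
  right v := (h v).toLinearMap.isLinear

theorem IsBilin.sub {A B : Eu n → Eu n → ℝ} (hA : IsBilin A) (hB : IsBilin B) :
    IsBilin fun v w => A v w - B v w where
  left w := (hA.left w).sub_fun (hB.left w)
  right v := (hA.right v).sub_fun (hB.right v)

theorem IsBilin.const_mul {A : Eu n → Eu n → ℝ} (hA : IsBilin A) (c : ℝ) :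
    IsBilin fun v w => c * A v w where
  left w := (hA.left w).const_mul_fun c
  right v := (hA.right v).const_mul_fun c

theorem isBilin_schouten : IsBilin (schouten G x) :=
  (isBilin_ric.sub ((isBilin_clm (G x)).const_mul _)).const_mul _

theorem weyl_swap₁₂ (a b c d : Eu n) : weyl G x a b c d = - weyl G x b a c d := by
  simp only [weyl, kulkarniNomizu, riem_swap₁₂ a b c d]
  ring

namespace IsMetricOn

variable (hG : IsMetricOn G U) (hx : x ∈ U)
include hG hx

theorem ric_eq (u v : Eu n) : ric G x u v = ∑ i, riem G x (e i) u v (eUp G x i) :=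
  Finset.sum_congr rfl fun i _ => (hG.apply_eUp' hx i _).symm

theorem ric_comm (u v : Eu n) : ric G x u v = ric G x v u := by
  rw [hG.ric_eq hx, hG.ric_eq hx]
  have hB : IsBilin fun a b => riem G x a u v b :=
    ⟨fun b => by simpa only [riem, hG.symm x hx _ b] using isLinearMap_curv₁ (G x b) u v,
      fun a => (G x _).toLinearMap.isLinear⟩
  rw [hG.contract_comm hx hB]
  refine Finset.sum_congr rfl fun i _ => ?_
  rw [hG.riem_pair hx, riem_swap₁₂, hG.riem_swap₃₄ hx, neg_neg]

theorem schouten_comm (u v : Eu n) : schouten G x u v = schouten G x v u := by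
  simp only [schouten]
  rw [hG.ric_comm hx, hG.symm x hx]

theorem weyl_swap₃₄ (a b c d : Eu n) : weyl G x a b c d = - weyl G x a b d c := by
  simp only [weyl, kulkarniNomizu, hG.riem_swap₃₄ hx a b c d]
  ring

theorem weyl_pair (a b c d : Eu n) : weyl G x a b c d = weyl G x c d a b := by
  simp only [weyl, kulkarniNomizu, hG.riem_pair hx a b c d]
  rw [hG.symm x hx a d, hG.symm x hx b c, hG.symm x hx a c, hG.symm x hx b d,
    hG.schouten_comm hx b c, hG.schouten_comm hx a d, hG.schouten_comm hx b d,
    hG.schouten_comm hx a c]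
  ring

theorem weyl_bianchi (a b c d : Eu n) :
    weyl G x a b c d + weyl G x b c a d + weyl G x c a b d = 0 := by
  have := congrArg (fun t => G x t d) (hG.curv_bianchi hx a b c)
  simp only [map_add, add_apply, map_zero, zero_apply] at this
  simp only [weyl, kulkarniNomizu, riem]
  rw [hG.symm x hx a b, hG.symm x hx a c, hG.symm x hx b c,
    hG.schouten_comm hx a b, hG.schouten_comm hx a c, hG.schouten_comm hx b c]
  linarith

omit hG hx in
theorem _root_.ConformalCotton.Loc.isLinearMap_weyl₁ (b c d : Eu n) :
    IsLinearMap ℝ fun a => weyl G x a b c d :=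
  ⟨fun a a' => weyl_add G x a a' b c d, fun r a => weyl_smul G x r a b c d⟩

omit hG hx in
theorem _root_.ConformalCotton.Loc.isLinearMap_weyl₂ (a c d : Eu n) :
    IsLinearMap ℝ fun b => weyl G x a b c d := by
  simp only [weyl_swap₁₂ a]
  exact (isLinearMap_weyl₁ a c d).neg_fun

/-- Pair symmetry moves the slot to the front, where linearity is built in; this is why slots three
and four need a metric. -/
theorem isLinearMap_weyl₃ (a b d : Eu n) : IsLinearMap ℝ fun c => weyl G x a b c d := by
  simp only [hG.weyl_pair hx a b]
  exact isLinearMap_weyl₁ d a b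

theorem isLinearMap_weyl₄ (a b c : Eu n) : IsLinearMap ℝ fun d => weyl G x a b c d := by
  simp only [hG.weyl_pair hx a b]
  exact isLinearMap_weyl₂ c a b

theorem sum_apply_self : ∑ i, G x (e i) (eUp G x i) = n := by
  have h : ∀ i, G x (e i) (eUp G x i) = 1 := fun i => by
    rw [hG.apply_eUp' hx]; simp [eps_apply, e]
  simp [h]

theorem sum_schouten (hn : 3 ≤ n) :
    ∑ i, schouten G x (e i) (eUp G x i) = scal G x / (2 * ((n : ℝ) - 1)) := by
  have h3 : (3 : ℝ) ≤ n := by exact_mod_cast hn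
  have h1 : (n : ℝ) - 1 ≠ 0 := by linarith
  have h2 : (n : ℝ) - 2 ≠ 0 := by linarith
  simp only [schouten]
  rw [← Finset.mul_sum, Finset.sum_sub_distrib, ← Finset.mul_sum, hG.sum_apply_self hx, ← scal]
  field_simp
  ring

/-- The trace of g ⊙ 𝔨 is (n-2)𝔨 + (tr 𝔨) g, and with tr 𝔨 = S/(2(n-1)) this is Ric. -/
theorem weyl_trace (hn : 3 ≤ n) (b c : Eu n) : ∑ i, weyl G x (e i) b c (eUp G x i) = 0 := by
  have h3 : (3 : ℝ) ≤ n := by exact_mod_cast hn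
  have h1 : (n : ℝ) - 1 ≠ 0 := by linarith
  have h2 : (n : ℝ) - 2 ≠ 0 := by linarith
  simp only [weyl, kulkarniNomizu]
  rw [Finset.sum_sub_distrib, ← hG.ric_eq hx, Finset.sum_sub_distrib, Finset.sum_sub_distrib,
    Finset.sum_add_distrib]
  simp only [hG.apply_eUp' hx _ b]
  rw [← Finset.sum_mul, ← Finset.mul_sum, hG.sum_apply_self hx, hG.sum_schouten hx hn,
    sum_eps_mul (isBilin_schouten.left c)]
  simp only [hG.symm x hx (e _) c]
  rw [hG.sum_apply_mul hx (isBilin_schouten.right b)]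
  simp only [schouten]
  field_simp
  ring

theorem weyl_trace₂₄ (hn : 3 ≤ n) (a c : Eu n) : ∑ i, weyl G x a (e i) c (eUp G x i) = 0 := by
  simp only [weyl_swap₁₂ a, Finset.sum_neg_distrib, hG.weyl_trace hx hn, neg_zero]

theorem weyl_self₃₄ (a b c : Eu n) : weyl G x a b c c = 0 := by
  linarith [hG.weyl_swap₃₄ hx a b c c]

theorem weyl_trace₃₄ (a b : Eu n) : ∑ i, weyl G x a b (e i) (eUp G x i) = 0 := by
  obtain ⟨f, hf⟩ := hG.exists_isFrame hx
  rw [hG.contract_eq hx ⟨fun w => hG.isLinearMap_weyl₃ hx a b w,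
    fun v => hG.isLinearMap_weyl₄ hx a b v⟩ hf]
  simp [hG.weyl_self₃₄ hx]

/-- With three indices, an off-diagonal trace has a single surviving term. The diagonal traces say
that the three sectional components have vanishing pairwise sums, so each of them is zero. -/
theorem weyl_eq_zero_of_dim_three (hn : n = 3) (a b c d : Eu n) : weyl G x a b c d = 0 := by
  subst hn
  obtain ⟨f, hf⟩ := hG.exists_isFrame hx
  have hB : ∀ b c, IsBilin fun a d => weyl G x a b c d := fun b c =>
    ⟨fun w => isLinearMap_weyl₁ b c w, fun v => hG.isLinearMap_weyl₄ hx v b c⟩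
  have htr : ∀ i j, ∑ k, weyl G x (f k) (f i) (f j) (f k) = 0 := fun i j => by
    rw [← hG.contract_eq hx (hB _ _) hf, hG.weyl_trace hx le_rfl]
  have h12 : ∀ i j k l, weyl G x (f i) (f j) (f k) (f l) = - weyl G x (f j) (f i) (f k) (f l) :=
    fun i j k l => weyl_swap₁₂ _ _ _ _
  have h34 : ∀ i j k l, weyl G x (f i) (f j) (f k) (f l) = - weyl G x (f i) (f j) (f l) (f k) :=
    fun i j k l => hG.weyl_swap₃₄ hx _ _ _ _
  have hp : ∀ i j k l, weyl G x (f i) (f j) (f k) (f l) = weyl G x (f k) (f l) (f i) (f j) :=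
    fun i j k l => hG.weyl_pair hx _ _ _ _
  generalize hT : (fun i j k l => weyl G x (f i) (f j) (f k) (f l)) = T
  have hTa : ∀ i j k l, weyl G x (f i) (f j) (f k) (f l) = T i j k l := fun i j k l => by rw [← hT]
  simp only [hTa, Fin.sum_univ_three] at htr h12 h34 hp
  have z12 : ∀ i k l, T i i k l = 0 := fun i k l => by linarith [h12 i i k l]
  have z34 : ∀ i k l, T k l i i = 0 := fun i k l => by linarith [h34 k l i i]
  have h0 : ∀ i j k l, T i j k l = 0 := by
    have hd : T 0 1 1 0 = 0 ∧ T 0 2 2 0 = 0 ∧ T 1 2 2 1 = 0 := by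
      have e0 := htr 0 0
      have e1 := htr 1 1
      have e2 := htr 2 2
      simp only [z12] at e0 e1 e2
      have s1 := h12 1 0 0 1
      have s2 := h12 2 0 0 2
      have s3 := h12 2 1 1 2
      have s4 := h34 0 1 0 1
      have s5 := h34 0 2 0 2
      have s6 := h34 1 2 1 2
      refine ⟨?_, ?_, ?_⟩ <;> linarith
    have ho : T 0 1 2 0 = 0 ∧ T 1 0 2 1 = 0 ∧ T 2 0 1 2 = 0 := by
      have e0 := htr 1 2
      have e1 := htr 0 2
      have e2 := htr 0 1
      simp only [z12, z34] at e0 e1 e2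
      refine ⟨?_, ?_, ?_⟩ <;> linarith
    obtain ⟨d1, d2, d3⟩ := hd
    obtain ⟨o1, o2, o3⟩ := ho
    intro i j k l
    fin_cases i <;> fin_cases j <;> fin_cases k <;> fin_cases l <;>
      simp only [Fin.zero_eta, Fin.mk_one, Fin.reduceFinMk, Fin.isValue, z12, z34] <;>
      first
      | assumption
      | grind
  have : ∀ v, ∑ i, G x v (f i) • f i = v := hf.expand
  rw [← this a, ← this b, ← this c, ← this d]
  simp only [← sum_mul_isLinearMap (isLinearMap_weyl₁ _ _ _),
    ← sum_mul_isLinearMap (isLinearMap_weyl₂ _ _ _),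
    ← sum_mul_isLinearMap (hG.isLinearMap_weyl₃ hx _ _ _),
    ← sum_mul_isLinearMap (hG.isLinearMap_weyl₄ hx _ _ _), hTa, h0]
  simp

/-! ### Smoothness -/

theorem contDiffAt_curv (u v w : Eu n) : ContDiffAt ℝ ∞ (fun y => curv G y u v w) x := by
  have hc := hG.contDiffAt_chr hx
  have hd := Loc.contDiffAt_fderiv hc
  have k : ∀ {v : Eu n}, ContDiffAt ℝ ∞ (fun _ : Eu n => v) x := contDiffAt_const
  exact ((((hd.clm_apply k).clm_apply k).clm_apply k).sub
    (((hd.clm_apply k).clm_apply k).clm_apply k)).add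
    ((hc.clm_apply k).clm_apply ((hc.clm_apply k).clm_apply k)) |>.sub
    ((hc.clm_apply k).clm_apply ((hc.clm_apply k).clm_apply k))

theorem contDiffAt_apply (v w : Eu n) : ContDiffAt ℝ ∞ (fun y => G y v w) x :=
  ((hG.contDiffAt x hx).clm_apply contDiffAt_const).clm_apply contDiffAt_const

theorem contDiffAt_ric (u v : Eu n) : ContDiffAt ℝ ∞ (fun y => ric G y u v) x :=
  ContDiffAt.sum fun _ _ => contDiffAt_const.clm_apply (hG.contDiffAt_curv hx _ _ _)

theorem contDiffAt_eUp (i : Fin n) : ContDiffAt ℝ ∞ (fun y => eUp G y i) x :=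
  (hG.contDiffAt_inverse hx).clm_apply contDiffAt_const

-- The moving vector `eUp G y i` is replaced by its coordinates, so that smoothness only has to be
-- known for constant arguments of `ric`.
omit hG hx in
theorem _root_.ConformalCotton.Loc.scal_eq :
    scal G x = ∑ i, ∑ j, eps j (eUp G x i) * ric G x (e i) (e j) :=
  Finset.sum_congr rfl fun _ _ => (sum_eps_mul (isBilin_ric.right _) _).symm

theorem contDiffAt_scal : ContDiffAt ℝ ∞ (fun y => scal G y) x := by
  simp only [scal_eq]
  exact ContDiffAt.sum fun _ _ => ContDiffAt.sum fun _ _ =>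
    (contDiffAt_const.clm_apply (hG.contDiffAt_eUp hx _)).mul (hG.contDiffAt_ric hx _ _)

theorem contDiffAt_schouten (u v : Eu n) : ContDiffAt ℝ ∞ (fun y => schouten G y u v) x :=
  contDiffAt_const.mul ((hG.contDiffAt_ric hx u v).sub
    ((contDiffAt_const.mul (hG.contDiffAt_scal hx)).mul (hG.contDiffAt_apply hx u v)))

theorem contDiffAt_weyl (a b c d : Eu n) : ContDiffAt ℝ ∞ (fun y => weyl G y a b c d) x := by
  have h := hG.contDiffAt_apply hx
  have s := hG.contDiffAt_schouten hx
  exact (((hG.contDiffAt x hx).clm_apply (hG.contDiffAt_curv hx a b c)).clm_apply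
    contDiffAt_const).sub ((((h a d).mul (s b c)).add ((h b c).mul (s a d))).sub
      ((h a c).mul (s b d)) |>.sub ((h b d).mul (s a c)))

end IsMetricOn

/-! ### Conformal changes -/

/-- `G'` is the metric `exp (-2 φ) G` on `U`. -/
structure IsConformalOn (G G' : LocalMetric n) (φ : Eu n → ℝ) (U : Set (Eu n)) : Prop where
  left : IsMetricOn G U
  right : IsMetricOn G' U
  smooth : ∀ y ∈ U, ContDiffAt ℝ ∞ φ y
  eq : ∀ y ∈ U, G' y = Real.exp (-2 * φ y) • G y

/-- The gradient of `φ`. -/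
def gradient (G : LocalMetric n) (φ : Eu n → ℝ) (x : Eu n) : Eu n := sharp G x (fderiv ℝ φ x)

/-- The Hessian of `φ`. -/
def hess (G : LocalMetric n) (φ : Eu n → ℝ) (x v w : Eu n) : ℝ :=
  fderiv ℝ (fderiv ℝ φ) x v w - fderiv ℝ φ x (chr G x v w)

/-- The covariant derivative of the gradient. -/
def hessUp (G : LocalMetric n) (φ : Eu n → ℝ) (x v : Eu n) : Eu n :=
  fderiv ℝ (gradient G φ) x v + chr G x v (gradient G φ x)

/-- The change of the Schouten tensor under the conformal change by `φ`. -/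
def schoutenChange (G : LocalMetric n) (φ : Eu n → ℝ) (x v w : Eu n) : ℝ :=
  hess G φ x v w + fderiv ℝ φ x v * fderiv ℝ φ x w
    - 1 / 2 * fderiv ℝ φ x (gradient G φ x) * G x v w

/-- The endomorphism associated with `schoutenChange`. -/
def schoutenChangeUp (G : LocalMetric n) (φ : Eu n → ℝ) (x v : Eu n) : Eu n :=
  hessUp G φ x v + fderiv ℝ φ x v • gradient G φ x
    - (1 / 2 * fderiv ℝ φ x (gradient G φ x)) • v

theorem isBilin_schoutenChange (φ : Eu n → ℝ) : IsBilin (schoutenChange G φ x) := by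
  constructor <;> intro w <;> constructor <;> intros <;>
    simp only [schoutenChange, hess, map_add, map_smul, add_apply, smul_apply, smul_eq_mul] <;>
    ring

namespace IsConformalOn

variable {G' : LocalMetric n} {φ : Eu n → ℝ} (h : IsConformalOn G G' φ U) (hx : x ∈ U)
include h hx

theorem apply_eq (v w : Eu n) : G' x v w = Real.exp (-2 * φ x) * G x v w := by
  rw [h.eq x hx]; rfl

theorem apply_gradient (v : Eu n) : G x (gradient G φ x) v = fderiv ℝ φ x v := by
  rw [gradient, h.left.apply_sharp hx]

theorem apply_gradient' (v : Eu n) : G x v (gradient G φ x) = fderiv ℝ φ x v := by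
  rw [h.left.symm x hx, h.apply_gradient hx]

theorem sharp_eq (θ : Eu n →L[ℝ] ℝ) : sharp G' x θ = Real.exp (2 * φ x) • sharp G x θ := by
  refine h.right.ext_left hx fun z => ?_
  rw [h.right.apply_sharp hx, h.apply_eq hx, map_smul, smul_apply, h.left.apply_sharp hx,
    smul_eq_mul, ← mul_assoc, ← Real.exp_add]
  simp

theorem eUp_eq (i : Fin n) : eUp G' x i = Real.exp (2 * φ x) • eUp G x i := h.sharp_eq hx _

theorem differentiableAt_fderiv : DifferentiableAt ℝ (fderiv ℝ φ) x :=
  (contDiffAt_fderiv (h.smooth x hx)).differentiableAt (by simp)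

theorem contDiffAt_gradient : ContDiffAt ℝ ∞ (gradient G φ) x :=
  (h.left.contDiffAt_inverse hx).clm_apply (contDiffAt_fderiv (h.smooth x hx))

theorem differentiableAt_gradient : DifferentiableAt ℝ (gradient G φ) x :=
  (h.contDiffAt_gradient hx).differentiableAt (by simp)

theorem fderiv_metric (u v w : Eu n) :
    fderiv ℝ G' x u v w = Real.exp (-2 * φ x) * fderiv ℝ G x u v w
      - 2 * fderiv ℝ φ x u * (Real.exp (-2 * φ x) * G x v w) := by
  have hφ : DifferentiableAt ℝ φ x := (h.smooth x hx).differentiableAt (by simp)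
  rw [← fderiv_apply_const₂ (h.right.differentiableAt hx)]
  have hE : (fun y => G' y v w) =ᶠ[𝓝 x] fun y => Real.exp (-2 * φ y) * G y v w := by
    filter_upwards [h.left.mem_nhds hx] with y hy using h.apply_eq hy v w
  have hd : DifferentiableAt ℝ (fun y => G y v w) x :=
    (h.left.contDiffAt_apply hx v w).differentiableAt (by simp)
  have he : HasFDerivAt (fun y => Real.exp (-2 * φ y))
      (Real.exp (-2 * φ x) • ((-2 : ℝ) • fderiv ℝ φ x)) x :=
    (hφ.hasFDerivAt.const_mul (-2 : ℝ)).exp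
  rw [hE.fderiv_eq, fderiv_fun_mul he.differentiableAt hd, he.fderiv]
  simp only [add_apply, smul_apply, smul_eq_mul, fderiv_apply_const₂ (h.left.differentiableAt hx)]
  ring

/-- Koszul's formula, where the three derivatives of the conformal factor give the three correction
terms. -/
theorem chr_eq (u v : Eu n) : chr G' x u v = chr G x u v - fderiv ℝ φ x u • v
    - fderiv ℝ φ x v • u + G x u v • gradient G φ x := by
  refine h.right.ext_left hx fun z => ?_
  have h1 := h.right.two_mul_chr hx u v z
  have h2 := h.left.two_mul_chr hx u v z
  simp only [h.fderiv_metric hx] at h1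
  rw [h.apply_eq hx] at h1 ⊢
  rw [h.apply_eq hx]
  simp only [map_add, map_sub, map_smul, add_apply, sub_apply, smul_apply, smul_eq_mul,
    h.apply_gradient hx]
  rw [h.left.symm x hx u z] at h1
  rw [h.left.symm x hx u z]
  rw [h.left.symm x hx v z] at h1
  rw [h.left.symm x hx v z]
  linear_combination h1 / 2 - Real.exp (-2 * φ x) / 2 * h2

/-- Differentiate G(∇φ, v) = dφ(v) and use metric compatibility. -/
theorem apply_hessUp (u v : Eu n) : G x (hessUp G φ x u) v = hess G φ x u v := by
  have hE : (fun y => G y (gradient G φ y) v) =ᶠ[𝓝 x] fun y => fderiv ℝ φ y v := by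
    filter_upwards [h.left.mem_nhds hx] with y hy using h.apply_gradient hy v
  have := congrArg (fun f : Eu n →L[ℝ] ℝ => f u) hE.fderiv_eq
  rw [fderiv_apply_fun₂ (h.left.differentiableAt hx) (h.differentiableAt_gradient hx)
    (differentiableAt_const v), fderiv_apply_const (h.differentiableAt_fderiv hx),
    h.left.fderiv_eq hx, h.apply_gradient hx] at this
  simp only [fderiv_fun_const, Pi.zero_apply, zero_apply, map_zero] at this
  rw [hessUp, hess, map_add, add_apply]
  linarith

theorem apply_schoutenChangeUp (u v : Eu n) :
    G x (schoutenChangeUp G φ x u) v = schoutenChange G φ x u v := by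
  simp only [schoutenChangeUp, schoutenChange, map_add, map_sub, map_smul, add_apply, sub_apply,
    smul_apply, smul_eq_mul, h.apply_gradient hx, h.apply_hessUp hx]

theorem fderiv_chr (u v w : Eu n) :
    fderiv ℝ (chr G') x u v w = fderiv ℝ (chr G) x u v w
      - fderiv ℝ (fderiv ℝ φ) x u v • w - fderiv ℝ (fderiv ℝ φ) x u w • v
      + (G x (chr G x u v) w + G x v (chr G x u w)) • gradient G φ x
      + G x v w • fderiv ℝ (gradient G φ) x u := by
  have hE : (fun y => chr G' y v w) =ᶠ[𝓝 x] fun y => chr G y v w - fderiv ℝ φ y v • w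
      - fderiv ℝ φ y w • v + G y v w • gradient G φ y := by
    filter_upwards [h.left.mem_nhds hx] with y hy using h.chr_eq hy v w
  have hc := h.left.differentiableAt_chr hx
  have h1 : DifferentiableAt ℝ (fun y => chr G y v w) x :=
    (hc.clm_apply (differentiableAt_const v)).clm_apply (differentiableAt_const w)
  have h2 : ∀ v, DifferentiableAt ℝ (fun y => fderiv ℝ φ y v) x := fun v =>
    (h.differentiableAt_fderiv hx).clm_apply (differentiableAt_const v)
  have h4 : DifferentiableAt ℝ (fun y => G y v w) x :=
    (h.left.contDiffAt_apply hx v w).differentiableAt (by simp)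
  have h5 := h.differentiableAt_gradient hx
  have hD := (((h1.hasFDerivAt.sub ((h2 v).hasFDerivAt.smul_const w)).sub
    ((h2 w).hasFDerivAt.smul_const v)).add (h4.hasFDerivAt.smul
      h5.hasFDerivAt)).congr_of_eventuallyEq hE
  rw [← fderiv_apply_const₂ (h.right.differentiableAt_chr hx), hD.fderiv]
  simp only [add_apply, sub_apply, smul_apply, ContinuousLinearMap.smulRight_apply,
    fderiv_apply_const₂ hc, fderiv_apply_const (h.differentiableAt_fderiv hx),
    fderiv_apply_const₂ (h.left.differentiableAt hx), h.left.fderiv_eq hx]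
  module

/-- The Hessian terms come from differentiating the correction of Γ, the quadratic ones from its
products; together they form the endomorphism version of g ⊙ A with A = `schoutenChange`. -/
theorem curv_eq (u v w : Eu n) :
    curv G' x u v w = curv G x u v w
      + schoutenChange G φ x v w • u - schoutenChange G φ x u w • v
      + G x v w • schoutenChangeUp G φ x u - G x u w • schoutenChangeUp G φ x v := by
  simp only [curv, h.fderiv_chr hx, h.chr_eq hx, schoutenChange, schoutenChangeUp, hess, hessUp,
    map_add, map_sub, map_smul, smul_eq_mul,
    h.apply_gradient' hx]
  rw [fderiv_fderiv_comm (h.smooth x hx) v u, h.left.chr_comm hx v u, h.left.symm x hx v u]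
  module

theorem riem_eq (u v w z : Eu n) :
    riem G' x u v w z = Real.exp (-2 * φ x) * (riem G x u v w z
      + kulkarniNomizu (fun a b => G x a b) (schoutenChange G φ x) u v w z) := by
  rw [riem, h.apply_eq hx, h.curv_eq hx]
  simp only [map_add, map_sub, map_smul, add_apply, sub_apply, smul_apply, smul_eq_mul,
    h.apply_schoutenChangeUp hx, kulkarniNomizu, riem]
  ring

theorem sum_schoutenChange : ∑ i, schoutenChange G φ x (e i) (eUp G x i)
    = ∑ i, eps i (schoutenChangeUp G φ x (e i)) := by
  refine Finset.sum_congr rfl fun i _ => ?_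
  rw [← h.apply_schoutenChangeUp hx, h.left.apply_eUp' hx]

theorem ric_eq (u v : Eu n) :
    ric G' x u v = ric G x u v + ((n : ℝ) - 2) * schoutenChange G φ x u v
      + (∑ i, schoutenChange G φ x (e i) (eUp G x i)) * G x u v := by
  have h1 : ∀ i : Fin n, eps i (e i) = 1 := fun i => by simp [eps_apply, e]
  simp only [ric, h.curv_eq hx, map_add, map_sub, map_smul, smul_eq_mul, Finset.sum_add_distrib,
    Finset.sum_sub_distrib, h1, ← Finset.mul_sum, h.sum_schoutenChange hx]
  simp only [mul_comm _ (eps _ u)]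
  rw [sum_eps_mul ((isBilin_schoutenChange φ).left v)]
  have h2 : ∑ i, G x (e i) v * eps i (schoutenChangeUp G φ x u) = schoutenChange G φ x u v := by
    simp only [mul_comm _ (eps _ _)]
    rw [sum_eps_mul ((isBilin_clm (G x)).left v), h.apply_schoutenChangeUp hx]
  rw [h2]
  simp
  ring

theorem scal_eq :
    scal G' x = Real.exp (2 * φ x) * (scal G x
      + 2 * ((n : ℝ) - 1) * ∑ i, schoutenChange G φ x (e i) (eUp G x i)) := by
  simp only [scal, h.eUp_eq hx, (isBilin_ric.right _).map_smul, smul_eq_mul, ← Finset.mul_sum,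
    h.ric_eq hx, Finset.sum_add_distrib, h.left.sum_apply_self hx]
  ring

/-- Ric changes by (n-2)A + (tr A) g and the rescaled scalar curvature by 2(n-1) tr A, so the trace
parts cancel. -/
theorem schouten_eq (hn : 3 ≤ n) (u v : Eu n) :
    schouten G' x u v = schouten G x u v + schoutenChange G φ x u v := by
  have h3 : (3 : ℝ) ≤ n := by exact_mod_cast hn
  have h1 : (n : ℝ) - 1 ≠ 0 := by linarith
  have h2 : (n : ℝ) - 2 ≠ 0 := by linarith
  have he : Real.exp (2 * φ x) * Real.exp (-2 * φ x) = 1 := by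
    rw [← Real.exp_add]; simp
  simp only [schouten, h.scal_eq hx, h.ric_eq hx, h.apply_eq hx]
  generalize ∑ i, schoutenChange G φ x (e i) (eUp G x i) = t
  have : Real.exp (2 * φ x) * (scal G x + 2 * ((n : ℝ) - 1) * t)
      * (Real.exp (-2 * φ x) * G x u v) = (scal G x + 2 * ((n : ℝ) - 1) * t) * G x u v := by
    linear_combination (scal G x + 2 * ((n : ℝ) - 1) * t) * G x u v * he
  rw [mul_assoc (1 / (2 * ((n : ℝ) - 1))), this]
  field_simp
  ring

/-- The Weyl tensor is conformally invariant. -/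
theorem weyl_eq (hn : 3 ≤ n) (a b c d : Eu n) :
    weyl G' x a b c d = Real.exp (-2 * φ x) * weyl G x a b c d := by
  -- The term g ⊙ A in the curvature is exactly what the Schouten tensor subtracts.
  simp only [weyl, kulkarniNomizu, h.riem_eq hx, h.schouten_eq hx hn, h.apply_eq hx]
  ring

end IsConformalOn

/-! ### Conformal change of the Cotton tensor and of the divergence of the Weyl tensor -/

theorem IsMetricOn.nablaWeyl_smul₄ (hG : IsMetricOn G U) (hx : x ∈ U) (r : ℝ)
    (u a b c d : Eu n) :
    nablaWeyl G x u a b c (r • d) = r * nablaWeyl G x u a b c d := by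
  have h4 : ∀ a b c, weyl G x a b c (r • d) = r * weyl G x a b c d := fun a b c =>
    (hG.isLinearMap_weyl₄ hx a b c).map_smul r d
  have hE : (fun y => weyl G y a b c (r • d)) =ᶠ[𝓝 x] fun y => r * weyl G y a b c d := by
    filter_upwards [hG.mem_nhds hx] with y hy using
      (hG.isLinearMap_weyl₄ hy a b c).map_smul r d
  have hd : DifferentiableAt ℝ (fun y => weyl G y a b c d) x :=
    (hG.contDiffAt_weyl hx a b c d).differentiableAt (by simp)
  rw [nablaWeyl, hE.fderiv_eq, fderiv_const_mul hd, map_smul,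
    (hG.isLinearMap_weyl₄ hx a b c).map_smul, nablaWeyl]
  simp only [h4, smul_apply, smul_eq_mul]
  ring

/-- The two terms containing Γ(u, v) cancel because the connection is torsion free. -/
theorem IsMetricOn.dSchouten_eq (hG : IsMetricOn G U) (hx : x ∈ U) (u v w : Eu n) :
    dSchouten G x u v w = fderiv ℝ (fun y => schouten G y v w) x u
      - fderiv ℝ (fun y => schouten G y u w) x v
      - schouten G x v (chr G x u w) + schouten G x u (chr G x v w) := by
  rw [dSchouten, nablaSchouten, nablaSchouten, hG.chr_comm hx v u]
  ring

namespace IsConformalOn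

variable {G' : LocalMetric n} {φ : Eu n → ℝ} (h : IsConformalOn G G' φ U) (hx : x ∈ U)
include h hx

theorem hasFDerivAt_apply_gradient :
    HasFDerivAt (fun y => fderiv ℝ φ y (gradient G φ y))
      (fderiv ℝ (fun y => fderiv ℝ φ y (gradient G φ y)) x) x :=
  ((h.differentiableAt_fderiv hx).clm_apply (h.differentiableAt_gradient hx)).hasFDerivAt

theorem fderiv_apply_gradient (u : Eu n) :
    fderiv ℝ (fun y => fderiv ℝ φ y (gradient G φ y)) x u
      = 2 * hess G φ x u (gradient G φ x) := by
  have h1 := h.apply_hessUp hx u (gradient G φ x)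
  rw [h.apply_gradient' hx, hessUp, map_add] at h1
  rw [fderiv_apply_fun (h.differentiableAt_fderiv hx) (h.differentiableAt_gradient hx)]
  simp only [hess] at h1 ⊢
  linarith

theorem hasFDerivAt_schoutenChange (v w : Eu n) :
    ∃ L : Eu n →L[ℝ] ℝ, HasFDerivAt (fun y => schoutenChange G φ y v w) L x ∧ ∀ u, L u =
      fderiv ℝ (fderiv ℝ (fderiv ℝ φ)) x u v w - fderiv ℝ (fderiv ℝ φ) x u (chr G x v w)
        - fderiv ℝ φ x (fderiv ℝ (chr G) x u v w)
        + fderiv ℝ (fderiv ℝ φ) x u v * fderiv ℝ φ x w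
        + fderiv ℝ φ x v * fderiv ℝ (fderiv ℝ φ) x u w
        - hess G φ x u (gradient G φ x) * G x v w
        - 1 / 2 * fderiv ℝ φ x (gradient G φ x)
          * (G x (chr G x u v) w + G x v (chr G x u w)) := by
  have hdd : DifferentiableAt ℝ (fderiv ℝ (fderiv ℝ φ)) x :=
    (contDiffAt_fderiv (contDiffAt_fderiv (h.smooth x hx))).differentiableAt (by simp)
  have hd := h.differentiableAt_fderiv hx
  have hc := h.left.differentiableAt_chr hx
  have h1 := ((hdd.clm_apply (differentiableAt_const v)).clm_apply
    (differentiableAt_const w)).hasFDerivAt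
  have h2' : DifferentiableAt ℝ (fun y => chr G y v w) x :=
    (hc.clm_apply (differentiableAt_const v)).clm_apply (differentiableAt_const w)
  have h2 := (hd.clm_apply h2').hasFDerivAt
  have h3 := fun v : Eu n => (hd.clm_apply (differentiableAt_const v)).hasFDerivAt
  have h4 := ((h.left.contDiffAt_apply hx v w).differentiableAt (by simp)).hasFDerivAt
  refine ⟨_, ((h1.sub h2).add ((h3 v).mul (h3 w))).sub
    (((h.hasFDerivAt_apply_gradient hx).const_mul (1 / 2)).mul h4), fun u => ?_⟩
  simp only [add_apply, sub_apply, smul_apply, smul_eq_mul, fderiv_apply_const hd,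
    fderiv_apply_const₂ hdd, fderiv_apply_fun hd h2', fderiv_apply_const₂ hc,
    fderiv_apply_const₂ (h.left.differentiableAt hx), h.left.fderiv_eq hx,
    h.fderiv_apply_gradient hx]
  ring

/-- The conformal change of `d^∇ 𝔨`. -/
theorem dSchouten_eq (hn : 3 ≤ n) (u v w : Eu n) :
    dSchouten G' x u v w = dSchouten G x u v w - weyl G x u v w (gradient G φ x) := by
  choose L hL hL' using fun v w => h.hasFDerivAt_schoutenChange hx v w
  have hS : ∀ u v w, fderiv ℝ (fun y => schouten G' y v w) x u
      = fderiv ℝ (fun y => schouten G y v w) x u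
        + L v w u := fun u v w => by
    have hE : (fun y => schouten G' y v w)
        =ᶠ[𝓝 x] fun y => schouten G y v w + schoutenChange G φ y v w := by
      filter_upwards [h.left.mem_nhds hx] with y hy using h.schouten_eq hy hn v w
    rw [hE.fderiv_eq, fderiv_fun_add
      ((h.left.contDiffAt_schouten hx v w).differentiableAt (by simp)) (hL v w).differentiableAt,
      (hL v w).fderiv]
    rfl
  have hB : ∀ v, IsLinearMap ℝ (schouten G x v) := isBilin_schouten.right
  rw [h.right.dSchouten_eq hx, h.left.dSchouten_eq hx]
  simp only [hS, hL', h.schouten_eq hx hn, h.chr_eq hx, (hB _).map_add, (hB _).map_sub,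
    (hB _).map_smul, smul_eq_mul, schoutenChange, hess, weyl, kulkarniNomizu, riem, curv, map_add,
    map_sub, map_smul, add_apply, sub_apply, h.apply_gradient' hx]
  -- Once the third derivatives of φ commute, skew-symmetrising ∇Hess φ leaves the curvature applied
  -- to dφ. The Schouten terms produced by the change of Γ reduce it to its Weyl part.
  have s3 := congrArg (fun L => L w)
    (fderiv_fderiv_comm (contDiffAt_fderiv (h.smooth x hx)) u v)
  rw [s3, fderiv_fderiv_comm (h.smooth x hx) v u, h.left.schouten_comm hx v u,
    h.left.chr_comm hx v u, h.left.symm x hx v u]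
  ring

/-- The coefficient 2 of dφ(u) W is -2 from the conformal factor plus 1 from each of the four slots.
-/
theorem nablaWeyl_eq (hn : 3 ≤ n) (u a b c d : Eu n) :
    nablaWeyl G' x u a b c d = Real.exp (-2 * φ x) * (nablaWeyl G x u a b c d
      + 2 * fderiv ℝ φ x u * weyl G x a b c d
      + fderiv ℝ φ x a * weyl G x u b c d + fderiv ℝ φ x b * weyl G x a u c d
      + fderiv ℝ φ x c * weyl G x a b u d + fderiv ℝ φ x d * weyl G x a b c u
      - G x u a * weyl G x (gradient G φ x) b c d - G x u b * weyl G x a (gradient G φ x) c d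
      - G x u c * weyl G x a b (gradient G φ x) d
      - G x u d * weyl G x a b c (gradient G φ x)) := by
  have hφ : DifferentiableAt ℝ φ x := (h.smooth x hx).differentiableAt (by simp)
  have hE : (fun y => weyl G' y a b c d)
      =ᶠ[𝓝 x] fun y => Real.exp (-2 * φ y) * weyl G y a b c d := by
    filter_upwards [h.left.mem_nhds hx] with y hy using h.weyl_eq hy hn a b c d
  have hd : DifferentiableAt ℝ (fun y => weyl G y a b c d) x :=
    (h.left.contDiffAt_weyl hx a b c d).differentiableAt (by simp)
  have he : HasFDerivAt (fun y => Real.exp (-2 * φ y))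
      (Real.exp (-2 * φ x) • ((-2 : ℝ) • fderiv ℝ φ x)) x :=
    (hφ.hasFDerivAt.const_mul (-2 : ℝ)).exp
  have l1 := fun b c d => isLinearMap_weyl₁ (G := G) (x := x) b c d
  have l2 := fun b c d => isLinearMap_weyl₂ (G := G) (x := x) b c d
  have l3 := h.left.isLinearMap_weyl₃ hx
  have l4 := h.left.isLinearMap_weyl₄ hx
  rw [nablaWeyl, ((he.mul hd.hasFDerivAt).congr_of_eventuallyEq hE).fderiv, nablaWeyl]
  simp only [h.weyl_eq hx hn, h.chr_eq hx, (l1 _ _ _).map_add, (l1 _ _ _).map_sub,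
    (l1 _ _ _).map_smul, (l2 _ _ _).map_add, (l2 _ _ _).map_sub,
    (l2 _ _ _).map_smul, (l3 _ _ _).map_add, (l3 _ _ _).map_sub,
    (l3 _ _ _).map_smul, (l4 _ _ _).map_add, (l4 _ _ _).map_sub,
    (l4 _ _ _).map_smul, smul_eq_mul, add_apply, smul_apply]
  ring

/-- The conformal change of the divergence of the Weyl tensor. -/
theorem divWeyl_eq (hn : 3 ≤ n) (a b c : Eu n) :
    divWeyl G' x a b c
      = divWeyl G x a b c - ((n : ℝ) - 3) * weyl G x a b c (gradient G φ x) := by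
  have he : Real.exp (2 * φ x) * Real.exp (-2 * φ x) = 1 := by
    rw [← Real.exp_add]; simp
  have l4 := h.left.isLinearMap_weyl₄ hx
  simp only [divWeyl, h.eUp_eq hx, h.right.nablaWeyl_smul₄ hx, h.nablaWeyl_eq hx hn, ← mul_assoc,
    he, one_mul]
  simp only [mul_assoc (2 : ℝ)]
  simp only [Finset.sum_add_distrib, Finset.sum_sub_distrib, ← Finset.mul_sum, ← Finset.sum_mul,
    h.left.weyl_trace hx hn, h.left.weyl_trace₂₄ hx hn, h.left.weyl_trace₃₄ hx,
    h.left.sum_apply_self hx, h.left.symm x hx (e _) a, h.left.symm x hx (e _) b,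
    h.left.symm x hx (e _) c]
  rw [h.left.sum_mul_eUp hx (l4 a b c), h.left.sum_eUp_mul hx (l4 a b c),
    h.left.sum_apply_mul hx (l4 _ b c), h.left.sum_apply_mul hx (l4 a _ c),
    h.left.sum_apply_mul hx (l4 a b _)]
  rw [← gradient]
  set F := gradient G φ x
  -- The count for W(a,b,c,F): 2 + 1 from the terms with dφ(u) and dφ(d), 1 from the third slot, -n
  -- from the trace in the fourth. By Bianchi the first and second slots contribute -1 together, so
  -- the total is 3 - n.
  have b1 := h.left.weyl_bianchi hx a b c F
  have b2 := h.left.weyl_pair hx F b c a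
  have b3 := h.left.weyl_pair hx a F c b
  have b4 := h.left.weyl_swap₃₄ hx a b F c
  have b5 := h.left.weyl_swap₃₄ hx c a F b
  have b6 := h.left.weyl_swap₃₄ hx c b F a
  have b7 := weyl_swap₁₂ (G := G) (x := x) c b a F
  linarith

end IsConformalOn

/-! ### Moore-Penrose inverses of symmetric endomorphisms -/

section MoorePenrose

variable {V : Type*} [AddCommGroup V] {h : V → V → ℝ}

/-- `h` is additive, symmetric and positive definite. -/
structure IsPosDef (h : V → V → ℝ) : Prop where
  add : ∀ u v w, h (u + v) w = h u w + h v w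
  symm : ∀ v w, h v w = h w v
  pos : ∀ v, v ≠ 0 → 0 < h v v

namespace IsPosDef

variable (hh : IsPosDef h)
include hh

theorem sub (u v w : V) : h (u - v) w = h u w - h v w := by
  have := hh.add (u - v) v w
  rw [sub_add_cancel] at this
  linarith

theorem sub_right (u v w : V) : h u (v - w) = h u v - h u w := by
  rw [hh.symm, hh.sub, hh.symm v, hh.symm w]

theorem ext {v w : V} (H : ∀ z, h v z = h w z) : v = w := by
  by_contra hne
  have h1 := hh.pos _ (sub_ne_zero.2 hne)
  rw [hh.sub, H] at h1
  simp at h1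

theorem eq_zero {v : V} (H : h v v = 0) : v = 0 := by
  by_contra hne
  exact (hh.pos v hne).ne' H

variable [Module ℝ V] {A B B' : V →ₗ[ℝ] V}

/-- AB and AB' are self-adjoint projections with the same range, so they agree, and likewise BA and
B'A. Then B = BAB = B'AB' = B'. -/
theorem moorePenrose_unique (hB : IsMoorePenrose h A B) (hB' : IsMoorePenrose h A B') :
    B = B' := by
  have a1 : ∀ v, A (B (A v)) = A v := fun v => LinearMap.congr_fun hB.aba v
  have a2 : ∀ v, A (B' (A v)) = A v := fun v => LinearMap.congr_fun hB'.aba v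
  have b1 : ∀ v, B (A (B v)) = B v := fun v => LinearMap.congr_fun hB.bab v
  have b2 : ∀ v, B' (A (B' v)) = B' v := fun v => LinearMap.congr_fun hB'.bab v
  have e1 : ∀ v, A (B v) = A (B' v) := fun v => hh.ext fun w => by
    rw [← a2 (B v), hB'.symm_ab, hB.symm_ab, a1, ← hB'.symm_ab]
  have e2 : ∀ v, B (A v) = B' (A v) := fun v => hh.ext fun w => by
    rw [hB.symm_ba, ← a2 w, ← hB.symm_ba, ← hB'.symm_ba, a1]
  ext v
  rw [← b1, e1, e2, b2]

/-- For self-adjoint A the kernel and the range are orthogonal complements. With P the projection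
onto the kernel, A + P is invertible, and B = (A + P)⁻¹ - P satisfies AB = BA = 1 - P. -/
theorem exists_isMoorePenrose [FiniteDimensional ℝ V] (hA : ∀ v w, h (A v) w = h v (A w)) :
    ∃ B, IsMoorePenrose h A B := by
  have hdisj : Disjoint (LinearMap.ker A) (LinearMap.range A) := by
    rw [Submodule.disjoint_def]
    rintro _ hv ⟨u, rfl⟩
    refine hh.eq_zero ?_
    rw [hA, LinearMap.mem_ker.1 hv]
    have := hh.sub_right u 0 0
    rw [sub_zero] at this
    linarith
  have hc : IsCompl (LinearMap.ker A) (LinearMap.range A) := by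
    refine ⟨hdisj, codisjoint_iff.2 ?_⟩
    apply Submodule.eq_top_of_finrank_eq
    have h1 := Submodule.finrank_sup_add_finrank_inf_eq (LinearMap.ker A) (LinearMap.range A)
    have h2 := A.finrank_range_add_finrank_ker
    rw [hdisj.eq_bot, finrank_bot] at h1
    omega
  let P : V →ₗ[ℝ] V := (LinearMap.ker A).projection (LinearMap.range A) hc
  have hPmem : ∀ v, A (P v) = 0 := fun v =>
    LinearMap.mem_ker.1 (Submodule.projection_apply_mem hc v)
  have hPker : ∀ v, A v = 0 → P v = v := fun v hv =>
    Submodule.projection_apply_of_mem_left hc (LinearMap.mem_ker.2 hv)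
  have hPA : ∀ v, P (A v) = 0 := fun v =>
    Submodule.projection_apply_of_mem_right hc (LinearMap.mem_range_self A v)
  have hinj : Function.Injective (A + P) := by
    rw [injective_iff_map_eq_zero]
    intro v hv
    rw [LinearMap.add_apply] at hv
    have h1 : P v = 0 := by
      have := congrArg P hv
      rwa [map_add, hPA, zero_add, map_zero, hPker _ (hPmem v)] at this
    rw [h1, add_zero] at hv
    rw [← hPker v hv, h1]
  let C := LinearEquiv.ofInjectiveEndo (A + P) hinj
  have hC1 : ∀ v, A (C.symm v) + P (C.symm v) = v := fun v => C.apply_symm_apply v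
  have hC2 : ∀ v, C.symm (A v + P v) = v := fun v => C.symm_apply_apply v
  have hCP : ∀ v, C.symm (P v) = P v := fun v => by
    have := hC2 (P v)
    rwa [hPmem, zero_add, hPker _ (hPmem v)] at this
  have hPC : ∀ v, P (C.symm v) = P v := fun v => by
    have := congrArg P (hC1 v)
    rwa [map_add, hPA, zero_add, hPker _ (hPmem _)] at this
  have hAB : ∀ v, A (C.symm v - P v) = v - P v := fun v => by
    rw [map_sub, hPmem, sub_zero, ← hPC, eq_sub_iff_add_eq, hC1]
  have hBA : ∀ v, C.symm (A v) - P (A v) = v - P v := fun v => by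
    have := hC2 v
    rw [map_add, hCP] at this
    rw [hPA, sub_zero, eq_sub_iff_add_eq, this]
  have hPs : ∀ v w, h (P v) w = h (P v) (P w) := fun v w => by
    obtain ⟨u, hu⟩ : w - P w ∈ LinearMap.range A := ⟨_, hAB w⟩
    have h1 : h (P v) (w - P w) = 0 := by
      rw [← hu, ← hA, hPmem]
      have := hh.sub 0 0 u
      rw [sub_zero] at this
      linarith
    rw [hh.sub_right] at h1
    linarith
  have hPs' : ∀ v w, h (v - P v) w = h v (w - P w) := fun v w => by
    rw [hh.sub, hh.sub_right, hPs v w, hh.symm v (P w), hPs w v, hh.symm (P w)]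
  refine ⟨(C.symm : V →ₗ[ℝ] V) - P, ?_, ?_, ?_, ?_⟩
  · ext v
    simp [hBA, hPmem]
  · ext v
    change C.symm (A (C.symm v - P v)) - P (A (C.symm v - P v)) = C.symm v - P v
    rw [hAB, map_sub, map_sub, hCP, hPker _ (hPmem v), sub_self, sub_zero]
  · intro v w
    change h (A (C.symm v - P v)) w = h v (A (C.symm w - P w))
    rw [hAB, hAB, hPs']
  · intro v w
    change h (C.symm (A v) - P (A v)) w = h v (C.symm (A w) - P (A w))
    rw [hBA, hBA, hPs']

theorem isMoorePenrose_moorePenrose [FiniteDimensional ℝ V]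
    (hA : ∀ v w, h (A v) w = h v (A w)) : IsMoorePenrose h A (moorePenrose h A) := by
  have H := hh.exists_isMoorePenrose hA
  rw [moorePenrose, dif_pos H]
  exact H.choose_spec

end IsPosDef

end MoorePenrose

/-! ### The endomorphism `𝔴` -/

namespace IsMetricOn

variable (hG : IsMetricOn G U) (hx : x ∈ U)
include hG hx

theorem isPosDef_coInner : IsPosDef (coInner G x) where
  add u v w := rfl
  symm v w := by
    rw [coInner, coInner, ← hG.apply_sharp hx v, hG.sharp_apply hx, hG.symm x hx,
      hG.apply_sharp hx]
  pos v hv := by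
    rw [coInner]
    nth_rw 1 [← hG.apply_sharp hx v]
    refine hG.pos x hx _ fun h0 => hv ?_
    rw [← hG.apply_sharp hx v, h0, map_zero]

/-- The wedge produces two Weyl terms, which the Bianchi identity merges into one. -/
theorem weylOp_wedge (i : Fin n) (θ : Eu n →L[ℝ] ℝ) (z t : Eu n) :
    weylOp G x (wedge (eps i) θ) z t = weyl G x z t (eUp G x i) (sharp G x θ) := by
  have l1 := fun b c d => isLinearMap_weyl₁ (G := G) (x := x) b c d
  have l4 := hG.isLinearMap_weyl₄ hx
  simp only [weylOp, wedge, sub_mul, Finset.sum_sub_distrib, mul_assoc, ← Finset.mul_sum]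
  simp only [hG.sum_eUp_mul hx (l1 _ _ _)]
  rw [hG.sum_eUp_mul hx (l4 _ z t), hG.sum_eUp_mul hx (l4 _ z t), ← eUp]
  have b1 := hG.weyl_bianchi hx z t (eUp G x i) (sharp G x θ)
  have b2 := hG.weyl_pair hx (sharp G x θ) z t (eUp G x i)
  have b3 := hG.weyl_swap₃₄ hx t (eUp G x i) (sharp G x θ) z
  linarith

theorem frakw_apply (θ : Eu n →L[ℝ] ℝ) (z : Eu n) :
    frakw G x θ z = ∑ i, ∑ p, ∑ q, weyl G x (eUp G x p) (eUp G x q) (eUp G x i) (sharp G x θ)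
      * weyl G x (e q) (e i) z (e p) := by
  have l3 := hG.isLinearMap_weyl₃ hx
  change covec _ z = _
  rw [covec_apply]
  · simp only [weylOp.eq_1 _ _ (weylOp _ _ _), hG.weylOp_wedge hx]
  · exact IsLinearMap.sum_fun fun i _ => IsLinearMap.sum_fun fun p _ =>
      IsLinearMap.sum_fun fun q _ => (l3 _ _ _).const_mul_fun _

theorem divForm_apply (z : Eu n) :
    divForm G x z = ∑ i, ∑ p, ∑ q, divWeyl G x (eUp G x p) (eUp G x q) (e i)
      * weyl G x (e q) (eUp G x i) z (e p) := by
  have l3 := hG.isLinearMap_weyl₃ hx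
  rw [divForm, covec_apply]
  · rfl
  · exact IsLinearMap.sum_fun fun i _ => IsLinearMap.sum_fun fun p _ =>
      IsLinearMap.sum_fun fun q _ => (l3 _ _ _).const_mul_fun _

/-- This sum arises when the correction term of δW is inserted into `divForm`; it differs from
`frakw_apply` only in which copy of the index i is raised. -/
theorem sum_weyl_mul_weyl (θ : Eu n →L[ℝ] ℝ) (z : Eu n) :
    ∑ i, ∑ p, ∑ q, weyl G x (eUp G x p) (eUp G x q) (e i) (sharp G x θ)
      * weyl G x (e q) (eUp G x i) z (e p) = frakw G x θ z := by
  have l2 := fun b c d => isLinearMap_weyl₂ (G := G) (x := x) b c d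
  have l3 := hG.isLinearMap_weyl₃ hx
  rw [hG.frakw_apply hx]
  refine hG.contract_comm hx (B := fun v w => ∑ p, ∑ q, weyl G x (eUp G x p) (eUp G x q) v
    (sharp G x θ) * weyl G x (e q) w z (e p)) ⟨fun w => ?_, fun v => ?_⟩
  · exact IsLinearMap.sum_fun fun p _ => IsLinearMap.sum_fun fun q _ =>
      (l3 _ _ _).mul_const_fun _
  · exact IsLinearMap.sum_fun fun p _ => IsLinearMap.sum_fun fun q _ =>
      (l2 _ _ _).const_mul_fun _

/-- A Gram form: self-adjointness of 𝔴 and the description of its kernel are read off from it. -/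
theorem frakw_apply_frame {f : Fin n → Eu n} (hf : IsFrame (G x) f) (θ : Eu n →L[ℝ] ℝ)
    (z : Eu n) :
    2 * frakw G x θ z = ∑ i, ∑ p, ∑ q, weyl G x (f p) (f q) (f i) (sharp G x θ)
      * weyl G x (f p) (f q) (f i) z := by
  have l1 := fun b c d => isLinearMap_weyl₁ (G := G) (x := x) b c d
  have l2 := fun b c d => isLinearMap_weyl₂ (G := G) (x := x) b c d
  have l3 := hG.isLinearMap_weyl₃ hx
  have l4 := hG.isLinearMap_weyl₄ hx
  have h0 : frakw G x θ z = ∑ i, ∑ p, ∑ q, weyl G x (f p) (f q) (f i) (sharp G x θ)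
      * weyl G x (f q) (f i) z (f p) := by
    rw [hG.frakw_apply hx]
    refine (hG.contract_eq hx (B := fun w v => ∑ p, ∑ q, weyl G x (eUp G x p) (eUp G x q) v
      (sharp G x θ) * weyl G x (e q) w z (e p)) ⟨fun w => ?_, fun v => ?_⟩ hf).trans ?_
    · exact IsLinearMap.sum_fun fun p _ => IsLinearMap.sum_fun fun q _ =>
        (l2 _ _ _).const_mul_fun _
    · exact IsLinearMap.sum_fun fun p _ => IsLinearMap.sum_fun fun q _ =>
        (l3 _ _ _).mul_const_fun _
    refine Finset.sum_congr rfl fun i _ => ?_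
    refine (hG.contract_eq hx (B := fun w v => ∑ q, weyl G x v (eUp G x q) (f i)
      (sharp G x θ) * weyl G x (e q) (f i) z w) ⟨fun w => ?_, fun v => ?_⟩ hf).trans ?_
    · exact IsLinearMap.sum_fun fun q _ => (l4 _ _ _).const_mul_fun _
    · exact IsLinearMap.sum_fun fun q _ => (l1 _ _ _).mul_const_fun _
    refine Finset.sum_congr rfl fun p _ => ?_
    exact hG.contract_eq hx (B := fun w v => weyl G x (f p) v (f i)
      (sharp G x θ) * weyl G x w (f i) z (f p)) ⟨fun w => (l1 _ _ _).const_mul_fun _,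
        fun v => (l2 _ _ _).mul_const_fun _⟩ hf
  rw [h0, Finset.mul_sum]
  refine Finset.sum_congr rfl fun i _ => ?_
  -- The first factor is skew in p and q, so the second may be skew-symmetrised; Bianchi turns the
  -- result into W(f_p, f_q, f_i, z).
  have h1 : ∑ p, ∑ q, weyl G x (f p) (f q) (f i) (sharp G x θ) * weyl G x (f q) (f i) z (f p)
      = - ∑ p, ∑ q, weyl G x (f p) (f q) (f i) (sharp G x θ) * weyl G x (f p) (f i) z (f q) := by
    rw [Finset.sum_comm, ← Finset.sum_neg_distrib]
    refine Finset.sum_congr rfl fun p _ => ?_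
    rw [← Finset.sum_neg_distrib]
    refine Finset.sum_congr rfl fun q _ => ?_
    rw [weyl_swap₁₂ (f q) (f p)]
    ring
  rw [two_mul]
  nth_rw 2 [h1]
  rw [← sub_eq_add_neg, ← Finset.sum_sub_distrib]
  refine Finset.sum_congr rfl fun p _ => ?_
  rw [← Finset.sum_sub_distrib]
  refine Finset.sum_congr rfl fun q _ => ?_
  rw [← mul_sub]
  congr 1
  have b1 := hG.weyl_bianchi hx (f p) (f q) (f i) z
  have b2 := hG.weyl_swap₃₄ hx (f q) (f i) z (f p)
  have b3 := hG.weyl_swap₃₄ hx (f p) (f i) z (f q)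
  have b4 := hG.weyl_bianchi hx (f q) (f i) (f p) z
  have b5 := weyl_swap₁₂ (G := G) (x := x) (f i) (f p) (f q) z
  have c1 := hG.weyl_pair hx (f q) (f i) z (f p)
  have c2 := hG.weyl_pair hx (f p) (f i) z (f q)
  have c3 := hG.weyl_bianchi hx z (f p) (f q) (f i)
  have c4 := weyl_swap₁₂ (G := G) (x := x) z (f q) (f p) (f i)
  have c5 := hG.weyl_swap₃₄ hx (f p) (f q) z (f i)
  linarith

theorem coInner_frakw (θ η : Eu n →L[ℝ] ℝ) :
    coInner G x (frakw G x θ) η = coInner G x θ (frakw G x η) := by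
  obtain ⟨f, hf⟩ := hG.exists_isFrame hx
  rw [(hG.isPosDef_coInner hx).symm θ, coInner, coInner]
  have h1 := hG.frakw_apply_frame hx hf θ (sharp G x η)
  have h2 := hG.frakw_apply_frame hx hf η (sharp G x θ)
  have : 2 * frakw G x θ (sharp G x η) = 2 * frakw G x η (sharp G x θ) := by
    rw [h1, h2]
    exact Finset.sum_congr rfl fun i _ => Finset.sum_congr rfl fun p _ =>
      Finset.sum_congr rfl fun q _ => mul_comm _ _
  linarith

/-- The kernel of `𝔴` is the nullity space of the Weyl tensor. -/
theorem frakw_eq_zero_iff (θ : Eu n →L[ℝ] ℝ) :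
    frakw G x θ = 0 ↔ ∀ a b c, weyl G x a b c (sharp G x θ) = 0 := by
  obtain ⟨f, hf⟩ := hG.exists_isFrame hx
  constructor
  · intro h0 a b c
    -- Evaluated at its own dual vector, 𝔴(θ) = 0 is a vanishing sum of squares.
    have h1 := hG.frakw_apply_frame hx hf θ (sharp G x θ)
    rw [h0, zero_apply, mul_zero, eq_comm, Finset.sum_eq_zero_iff_of_nonneg
      fun i _ => Finset.sum_nonneg fun p _ => Finset.sum_nonneg fun q _ => mul_self_nonneg _] at h1
    have h2 : ∀ p q i, weyl G x (f p) (f q) (f i) (sharp G x θ) = 0 := fun p q i => by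
      have h3 := h1 i (Finset.mem_univ i)
      rw [Finset.sum_eq_zero_iff_of_nonneg
        fun p _ => Finset.sum_nonneg fun q _ => mul_self_nonneg _] at h3
      have h4 := h3 p (Finset.mem_univ p)
      rw [Finset.sum_eq_zero_iff_of_nonneg fun q _ => mul_self_nonneg _] at h4
      exact mul_self_eq_zero.1 (h4 q (Finset.mem_univ q))
    rw [← hf.expand a, ← hf.expand b, ← hf.expand c]
    simp only [← sum_mul_isLinearMap (isLinearMap_weyl₁ _ _ _),
      ← sum_mul_isLinearMap (isLinearMap_weyl₂ _ _ _),
      ← sum_mul_isLinearMap (hG.isLinearMap_weyl₃ hx _ _ _), h2]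
    simp
  · intro h0
    ext z
    have h1 := hG.frakw_apply_frame hx hf θ z
    simp only [h0, zero_mul, Finset.sum_const_zero] at h1
    rw [zero_apply]
    linarith

theorem isMoorePenrose_frakw :
    IsMoorePenrose (coInner G x) (frakw G x) (moorePenrose (coInner G x) (frakw G x)) :=
  (hG.isPosDef_coInner hx).isMoorePenrose_moorePenrose (hG.coInner_frakw hx)

end IsMetricOn

/-! ### Conformal change of the vector field `𝕋` -/

namespace IsMetricOn

variable (hG : IsMetricOn G U) (hx : x ∈ U)
include hG hx

theorem nablaWeyl_smul₁ (r : ℝ) (u a b c d : Eu n) :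
    nablaWeyl G x u (r • a) b c d = r * nablaWeyl G x u a b c d := by
  have h1 : ∀ b c d, weyl G x (r • a) b c d = r * weyl G x a b c d := weyl_smul G x r a
  have hd : DifferentiableAt ℝ (fun y => weyl G y a b c d) x :=
    (hG.contDiffAt_weyl hx a b c d).differentiableAt (by simp)
  simp only [nablaWeyl, weyl_smul, map_smul]
  rw [fderiv_const_mul hd]
  simp only [smul_apply, smul_eq_mul]
  ring

theorem nablaWeyl_swap₁₂ (u a b c d : Eu n) :
    nablaWeyl G x u a b c d = - nablaWeyl G x u b a c d := by
  have hd : DifferentiableAt ℝ (fun y => weyl G y b a c d) x :=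
    (hG.contDiffAt_weyl hx b a c d).differentiableAt (by simp)
  have hE : (fun y => weyl G y a b c d) = fun y => - weyl G y b a c d :=
    funext fun y => weyl_swap₁₂ _ _ _ _
  rw [nablaWeyl, hE, fderiv_fun_neg, nablaWeyl, weyl_swap₁₂ (chr G x u a),
    weyl_swap₁₂ a (chr G x u b), weyl_swap₁₂ a b, weyl_swap₁₂ a b, neg_apply]
  ring

theorem divWeyl_smul₁ (r : ℝ) (a b c : Eu n) :
    divWeyl G x (r • a) b c = r * divWeyl G x a b c := by
  simp only [divWeyl, hG.nablaWeyl_smul₁ hx, Finset.mul_sum]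

theorem divWeyl_smul₂ (r : ℝ) (a b c : Eu n) :
    divWeyl G x a (r • b) c = r * divWeyl G x a b c := by
  simp only [divWeyl, hG.nablaWeyl_swap₁₂ hx _ a, hG.nablaWeyl_smul₁ hx, Finset.mul_sum, mul_neg]

end IsMetricOn

namespace IsConformalOn

variable {G' : LocalMetric n} {φ : Eu n → ℝ} (h : IsConformalOn G G' φ U) (hx : x ∈ U)
include h hx

/-- Two Weyl factors contribute e^{-4φ}; three raised basis vectors and θ^♯ contribute e^{8φ}. -/
theorem frakw_eq (hn : 3 ≤ n) : frakw G' x = Real.exp (2 * φ x) ^ 2 • frakw G x := by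
  have he : Real.exp (-2 * φ x) * Real.exp (2 * φ x) = 1 := by
    rw [← Real.exp_add]; simp
  refine LinearMap.ext fun θ => ?_
  ext z
  have l1 := fun b c d => isLinearMap_weyl₁ (G := G) (x := x) b c d
  have l2 := fun b c d => isLinearMap_weyl₂ (G := G) (x := x) b c d
  have l3 := h.left.isLinearMap_weyl₃ hx
  have l4 := h.left.isLinearMap_weyl₄ hx
  rw [LinearMap.smul_apply, smul_apply, h.right.frakw_apply hx, h.left.frakw_apply hx, smul_eq_mul]
  simp only [Finset.mul_sum]
  refine Finset.sum_congr rfl fun i _ => Finset.sum_congr rfl fun p _ =>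
    Finset.sum_congr rfl fun q _ => ?_
  simp only [h.weyl_eq hx hn, h.eUp_eq hx, h.sharp_eq hx, (l1 _ _ _).map_smul, (l2 _ _ _).map_smul,
    (l3 _ _ _).map_smul, (l4 _ _ _).map_smul, smul_eq_mul]
  generalize Real.exp (-2 * φ x) = s at *
  generalize Real.exp (2 * φ x) = t at *
  generalize weyl G x (eUp G x p) (eUp G x q) (eUp G x i) (sharp G x θ) = X
  generalize weyl G x (e q) (e i) z (e p) = Y
  linear_combination (X * Y * t ^ 2 * (s * t + 1)) * he

/-- Three raised indices give e^{6φ} and the Weyl factor e^{-2φ}; δW has no factor but brings in the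
gradient term. -/
theorem divForm_eq (hn : 3 ≤ n) : divForm G' x = Real.exp (2 * φ x) ^ 2 •
    (divForm G x - ((n : ℝ) - 3) • frakw G x (fderiv ℝ φ x)) := by
  have he : Real.exp (-2 * φ x) * Real.exp (2 * φ x) = 1 := by
    rw [← Real.exp_add]; simp
  ext z
  have l2 := fun b c d => isLinearMap_weyl₂ (G := G) (x := x) b c d
  rw [smul_apply, sub_apply, smul_apply, h.right.divForm_apply hx, h.left.divForm_apply hx,
    ← h.left.sum_weyl_mul_weyl hx, smul_eq_mul, smul_eq_mul]
  simp only [Finset.mul_sum, ← Finset.sum_sub_distrib]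
  refine Finset.sum_congr rfl fun i _ => Finset.sum_congr rfl fun p _ =>
    Finset.sum_congr rfl fun q _ => ?_
  simp only [h.eUp_eq hx, h.right.divWeyl_smul₁ hx, h.right.divWeyl_smul₂ hx,
    h.divWeyl_eq hx hn, h.weyl_eq hx hn, (l2 _ _ _).map_smul, smul_eq_mul]
  rw [← gradient]
  generalize Real.exp (-2 * φ x) = s at *
  generalize Real.exp (2 * φ x) = t at *
  generalize weyl G x (eUp G x p) (eUp G x q) (e i) (gradient G φ x) = X
  generalize weyl G x (e q) (eUp G x i) z (e p) = Y
  generalize divWeyl G x (eUp G x p) (eUp G x q) (e i) = Z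
  linear_combination (t ^ 2 * (Z - (n - 3) * X) * Y) * he

/-- Rescaling the inner product does not affect self-adjointness, so only the factor of 𝔴 is
inverted, and uniqueness applies. -/
theorem moorePenrose_eq (hn : 3 ≤ n) : moorePenrose (coInner G' x) (frakw G' x)
    = (Real.exp (2 * φ x) ^ 2)⁻¹ • moorePenrose (coInner G x) (frakw G x) := by
  refine (h.right.isPosDef_coInner hx).moorePenrose_unique (h.right.isMoorePenrose_frakw hx) ?_
  have H := h.left.isMoorePenrose_frakw hx
  have ht : Real.exp (2 * φ x) ^ 2 ≠ 0 := by positivity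
  have hco : ∀ α β, coInner G' x α β = Real.exp (2 * φ x) * coInner G x α β := fun α β => by
    rw [coInner, coInner, h.sharp_eq hx, map_smul, smul_eq_mul]
  rw [h.frakw_eq hx hn]
  refine ⟨?_, ?_, fun v w => ?_, fun v w => ?_⟩
  · simp only [LinearMap.comp_smul, LinearMap.smul_comp, H.aba, smul_smul]
    congr 1
    field_simp
  · simp only [LinearMap.comp_smul, LinearMap.smul_comp, H.bab, smul_smul]
    congr 1
    field_simp
  · simp only [LinearMap.smul_apply, map_smul, smul_smul, inv_mul_cancel₀ ht, one_smul, hco,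
      H.symm_ab]
  · simp only [LinearMap.smul_apply, map_smul, smul_smul, mul_inv_cancel₀ ht, one_smul, hco,
      H.symm_ba]

/-- The conformal change of `𝕋`; the vector `P` is the orthogonal projection of the gradient to the
complement of the nullity space. -/
theorem fieldT_eq (hn : 4 ≤ n) : ∃ P : Eu n,
    (∀ a b c, weyl G x (gradient G φ x - P) a b c = 0) ∧
    (∀ v, (∀ a b c, weyl G x v a b c = 0) → G x v P = 0) ∧
    fieldT G' x = Real.exp (2 * φ x) • (fieldT G x - P) := by
  have hn3 : 3 ≤ n := by omega
  have h4 : (4 : ℝ) ≤ n := by exact_mod_cast hn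
  have hn0 : (n : ℝ) - 3 ≠ 0 := by linarith
  have ht : Real.exp (2 * φ x) ^ 2 ≠ 0 := by positivity
  set B := moorePenrose (coInner G x) (frakw G x) with hBdef
  have H : IsMoorePenrose (coInner G x) (frakw G x) B := h.left.isMoorePenrose_frakw hx
  -- Since 𝔴^# 𝔴 is the orthogonal projection along ker 𝔴, this covector is dual to the 𝓔^⊥-part of
  -- the gradient.
  set θ := B (frakw G x (fderiv ℝ φ x)) with hθ
  have h14 : ∀ v a b c, weyl G x v a b c = weyl G x b c v a := fun v a b c =>
    h.left.weyl_pair hx _ _ _ _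
  have h34 := h.left.weyl_swap₃₄ hx
  refine ⟨sharp G x θ, fun a b c => ?_, fun v hv => ?_, ?_⟩
  · have h0 : frakw G x (fderiv ℝ φ x - θ) = 0 := by
      rw [map_sub, sub_eq_zero]
      exact (LinearMap.congr_fun H.aba _).symm
    have h1 := (h.left.frakw_eq_zero_iff hx _).1 h0 b c a
    rw [h14, h34, neg_eq_zero, ← h1]
    congr 1
    exact (map_sub (G x).inverse _ _).symm
  · have h0 : frakw G x (G x v) = 0 := by
      rw [h.left.frakw_eq_zero_iff hx, h.left.sharp_apply hx]
      intro a b c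
      rw [h34, ← h14, hv, neg_zero]
    have h1 := H.symm_ba (fderiv ℝ φ x) (G x v)
    rw [h0, map_zero, coInner, coInner, h.left.sharp_apply hx, ← hθ, sharp, map_zero,
      map_zero] at h1
    rw [h.left.symm x hx, h.left.apply_sharp hx, h1]
  -- The factors e^{4φ} and n - 3 cancel against their inverses; the surviving e^{2φ} comes from
  -- raising the index.
  · rw [fieldT, fieldT, h.moorePenrose_eq hx hn3, h.divForm_eq hx hn3, h.sharp_eq hx,
      LinearMap.smul_apply, map_smul, smul_smul _ _ (B _), inv_mul_cancel₀ ht, one_smul, map_sub,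
      map_smul, ← hθ, smul_sub, smul_smul _ _ θ, one_div, inv_mul_cancel₀ hn0, one_smul]
    congr 1
    exact map_sub (G x).inverse _ _

end IsConformalOn

/-! ### Naturality of the Weyl tensor -/

namespace IsMetricOn

variable (hG : IsMetricOn G U) (hx : x ∈ U)
include hG hx

/-- Isometries carry orthonormal frames to orthonormal frames but do not respect coordinate bases,
so naturality needs traces in this form. -/
theorem ric_eq_frame {f : Fin n → Eu n} (hf : IsFrame (G x) f) (u v : Eu n) :
    ric G x u v = ∑ i, riem G x (f i) u v (f i) := by
  rw [hG.ric_eq hx]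
  exact hG.contract_eq hx (B := fun a b => riem G x a u v b)
    ⟨fun b => by simpa only [riem, hG.symm x hx _ b] using isLinearMap_curv₁ (G x b) u v,
      fun a => (G x _).toLinearMap.isLinear⟩ hf

theorem scal_eq_frame {f : Fin n → Eu n} (hf : IsFrame (G x) f) :
    scal G x = ∑ i, ric G x (f i) (f i) :=
  hG.contract_eq hx isBilin_ric hf

end IsMetricOn

/-- `F` is an isometry from the metric `G₁` on `U₁` to the metric `G₂` on `U₂`. -/
structure IsIsometryOn (F : Eu n → Eu n) (G₁ : LocalMetric n) (U₁ : Set (Eu n))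
    (G₂ : LocalMetric n) (U₂ : Set (Eu n)) : Prop where
  left : IsMetricOn G₁ U₁
  right : IsMetricOn G₂ U₂
  mapsTo : ∀ y ∈ U₁, F y ∈ U₂
  smooth : ∀ y ∈ U₁, ContDiffAt ℝ ∞ F y
  eq : ∀ y ∈ U₁, ∀ v w, G₁ y v w = G₂ (F y) (fderiv ℝ F y v) (fderiv ℝ F y w)

namespace IsIsometryOn

variable {F : Eu n → Eu n} {G₁ G₂ : LocalMetric n} {U₁ U₂ : Set (Eu n)}
  (h : IsIsometryOn F G₁ U₁ G₂ U₂) (hx : x ∈ U₁)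
include h hx

theorem differentiableAt : DifferentiableAt ℝ F x :=
  (h.smooth x hx).differentiableAt (by simp)

theorem differentiableAt_fderiv : DifferentiableAt ℝ (fderiv ℝ F) x :=
  (contDiffAt_fderiv (h.smooth x hx)).differentiableAt (by simp)

theorem bijective : Function.Bijective (fderiv ℝ F x) := by
  have hinj : Function.Injective (fderiv ℝ F x) := by
    rw [injective_iff_map_eq_zero]
    intro v hv
    by_contra hne
    have := h.left.pos x hx v hne
    rw [h.eq x hx, hv] at this
    simp at this
  exact ⟨hinj, (LinearMap.injective_iff_surjective (f := (fderiv ℝ F x : Eu n →ₗ[ℝ] Eu n))).1 hinj⟩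

theorem fderiv_metric (u v w : Eu n) :
    fderiv ℝ G₁ x u v w
      = fderiv ℝ G₂ (F x) (fderiv ℝ F x u) (fderiv ℝ F x v) (fderiv ℝ F x w)
        + G₂ (F x) (fderiv ℝ (fderiv ℝ F) x u v) (fderiv ℝ F x w)
        + G₂ (F x) (fderiv ℝ F x v) (fderiv ℝ (fderiv ℝ F) x u w) := by
  have hd := h.differentiableAt_fderiv hx
  have hE : (fun y => G₁ y v w)
      =ᶠ[𝓝 x] fun y => G₂ (F y) (fderiv ℝ F y v) (fderiv ℝ F y w) := by
    filter_upwards [h.left.mem_nhds hx] with y hy using h.eq y hy v w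
  have h2 := h.right.differentiableAt (h.mapsTo x hx)
  have hv : ∀ v, DifferentiableAt ℝ (fun y => fderiv ℝ F y v) x := fun v =>
    hd.clm_apply (differentiableAt_const v)
  have h3 : DifferentiableAt ℝ (fun y => G₂ (F y)) x := h2.comp x (h.differentiableAt hx)
  have h5 : fderiv ℝ (fun y => G₂ (F y)) x = (fderiv ℝ G₂ (F x)).comp (fderiv ℝ F x) :=
    fderiv_comp x h2 (h.differentiableAt hx)
  rw [← fderiv_apply_const₂ (h.left.differentiableAt hx), hE.fderiv_eq,
    fderiv_apply_fun₂ h3 (hv v) (hv w), fderiv_apply_const hd, fderiv_apply_const hd, h5]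
  rfl

/-- The transformation law of Christoffel symbols: both sides have the same pairing, by Koszul's
formula, with every vector in the image of dF, which is everything. -/
theorem fderiv_apply_chr (u v : Eu n) :
    fderiv ℝ F x (chr G₁ x u v) = chr G₂ (F x) (fderiv ℝ F x u) (fderiv ℝ F x v)
      + fderiv ℝ (fderiv ℝ F) x u v := by
  refine h.right.ext_left (h.mapsTo x hx) fun z => ?_
  obtain ⟨w, rfl⟩ := (h.bijective hx).2 z
  have h1 := h.left.two_mul_chr hx u v w
  have h2 := h.right.two_mul_chr (h.mapsTo x hx) (fderiv ℝ F x u) (fderiv ℝ F x v)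
    (fderiv ℝ F x w)
  rw [h.eq x hx] at h1
  simp only [h.fderiv_metric hx] at h1
  have s := h.right.symm _ (h.mapsTo x hx)
  have d := fderiv_fderiv_comm (h.smooth x hx)
  rw [s (fderiv ℝ F x v), s (fderiv ℝ F x u), d v u, d w u, d w v,
    s (fderiv ℝ F x u) (fderiv ℝ (fderiv ℝ F) x v w)] at h1
  rw [map_add, add_apply]
  linarith

theorem fderiv_apply_fderiv_chr (u v w : Eu n) :
    fderiv ℝ F x (fderiv ℝ (chr G₁) x u v w)
      = fderiv ℝ (chr G₂) (F x) (fderiv ℝ F x u) (fderiv ℝ F x v) (fderiv ℝ F x w)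
        + chr G₂ (F x) (fderiv ℝ (fderiv ℝ F) x u v) (fderiv ℝ F x w)
        + chr G₂ (F x) (fderiv ℝ F x v) (fderiv ℝ (fderiv ℝ F) x u w)
        + fderiv ℝ (fderiv ℝ (fderiv ℝ F)) x u v w
        - fderiv ℝ (fderiv ℝ F) x u (chr G₁ x v w) := by
  have hd := h.differentiableAt_fderiv hx
  have hdd : DifferentiableAt ℝ (fderiv ℝ (fderiv ℝ F)) x :=
    (contDiffAt_fderiv (contDiffAt_fderiv (h.smooth x hx))).differentiableAt (by simp)
  have hE : (fun y => fderiv ℝ F y (chr G₁ y v w))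
      =ᶠ[𝓝 x] fun y => chr G₂ (F y) (fderiv ℝ F y v) (fderiv ℝ F y w)
        + fderiv ℝ (fderiv ℝ F) y v w := by
    filter_upwards [h.left.mem_nhds hx] with y hy using h.fderiv_apply_chr hy v w
  have hc := h.left.differentiableAt_chr hx
  have h1 : DifferentiableAt ℝ (fun y => chr G₁ y v w) x :=
    (hc.clm_apply (differentiableAt_const v)).clm_apply (differentiableAt_const w)
  have h2 := h.right.differentiableAt_chr (h.mapsTo x hx)
  have h3 : DifferentiableAt ℝ (fun y => chr G₂ (F y)) x := h2.comp x (h.differentiableAt hx)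
  have h5 : fderiv ℝ (fun y => chr G₂ (F y)) x
      = (fderiv ℝ (chr G₂) (F x)).comp (fderiv ℝ F x) :=
    fderiv_comp x h2 (h.differentiableAt hx)
  have hv : ∀ v, DifferentiableAt ℝ (fun y => fderiv ℝ F y v) x := fun v =>
    hd.clm_apply (differentiableAt_const v)
  have h4 : DifferentiableAt ℝ (fun y => fderiv ℝ (fderiv ℝ F) y v w) x :=
    (hdd.clm_apply (differentiableAt_const v)).clm_apply (differentiableAt_const w)
  have key := congrArg (fun L : Eu n →L[ℝ] Eu n => L u) hE.fderiv_eq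
  rw [fderiv_apply_fun hd h1, fderiv_apply_const₂ hc,
    fderiv_fun_add ((h3.clm_apply (hv v)).clm_apply (hv w)) h4, add_apply,
    fderiv_apply_fun₂ h3 (hv v) (hv w), fderiv_apply_const hd, fderiv_apply_const hd,
    fderiv_apply_const₂ hdd, h5] at key
  rw [eq_sub_iff_add_eq', key]
  rfl

/-- The inhomogeneous terms are second and third derivatives of F and cancel by their symmetry. -/
theorem fderiv_apply_curv (u v w : Eu n) :
    fderiv ℝ F x (curv G₁ x u v w)
      = curv G₂ (F x) (fderiv ℝ F x u) (fderiv ℝ F x v) (fderiv ℝ F x w) := by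
  have d3 := congrArg (fun L => L w)
    (fderiv_fderiv_comm (contDiffAt_fderiv (h.smooth x hx)) u v)
  simp only [curv, map_add, map_sub, h.fderiv_apply_chr hx, h.fderiv_apply_fderiv_chr hx]
  rw [d3, fderiv_fderiv_comm (h.smooth x hx) u v]
  abel

theorem isFrame_comp {f : Fin n → Eu n} (hf : IsFrame (G₁ x) f) :
    IsFrame (G₂ (F x)) fun i => fderiv ℝ F x (f i) where
  ortho i j := by rw [← h.eq x hx, hf.ortho]
  expand v := by
    obtain ⟨w, rfl⟩ := (h.bijective hx).2 v
    simp only [← h.eq x hx, ← map_smul]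
    rw [← map_sum, hf.expand]

theorem riem_eq (u v w z : Eu n) : riem G₁ x u v w z
    = riem G₂ (F x) (fderiv ℝ F x u) (fderiv ℝ F x v) (fderiv ℝ F x w) (fderiv ℝ F x z) := by
  rw [riem, riem, h.eq x hx, h.fderiv_apply_curv hx]

theorem ric_eq (u v : Eu n) :
    ric G₁ x u v = ric G₂ (F x) (fderiv ℝ F x u) (fderiv ℝ F x v) := by
  obtain ⟨f, hf⟩ := h.left.exists_isFrame hx
  rw [h.left.ric_eq_frame hx hf, h.right.ric_eq_frame (h.mapsTo x hx) (h.isFrame_comp hx hf)]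
  simp only [h.riem_eq hx]

theorem scal_eq : scal G₁ x = scal G₂ (F x) := by
  obtain ⟨f, hf⟩ := h.left.exists_isFrame hx
  rw [h.left.scal_eq_frame hx hf, h.right.scal_eq_frame (h.mapsTo x hx) (h.isFrame_comp hx hf)]
  simp only [h.ric_eq hx]

/-- The Weyl tensor is natural. -/
theorem weyl_eq (a b c d : Eu n) : weyl G₁ x a b c d
    = weyl G₂ (F x) (fderiv ℝ F x a) (fderiv ℝ F x b) (fderiv ℝ F x c) (fderiv ℝ F x d) := by
  simp only [weyl, kulkarniNomizu, schouten, h.riem_eq hx, h.ric_eq hx, h.scal_eq hx, h.eq x hx]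

end IsIsometryOn

end Loc

/-! ### The local expressions of a metric on a manifold -/

namespace Loc

theorem IsMetricOn.mono {n : ℕ} {G : LocalMetric n} {U V : Set (Eu n)} (hG : IsMetricOn G U)
    (hV : IsOpen V) (hVU : V ⊆ U) : IsMetricOn G V :=
  ⟨hV, fun y hy => hG.contDiffAt y (hVU hy), fun y hy => hG.symm y (hVU hy),
    fun y hy => hG.pos y (hVU hy)⟩

end Loc

variable {n : ℕ} {M : Type*} [TopologicalSpace M] [ChartedSpace (Eu n) M]

/-- The metric at a point, as a form on the coordinate space. -/
def metricAt [IsManifold 𝓘(ℝ, Eu n) ∞ M] (g : RiemMetric n M) (q : M) :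
    Eu n →L[ℝ] Eu n →L[ℝ] ℝ := g.inner q

/-- The derivative of the inverse of the preferred chart around `p`. -/
def symmDeriv (p : M) (x : Eu n) : Eu n →L[ℝ] Eu n :=
  mfderiv 𝓘(ℝ, Eu n) 𝓘(ℝ, Eu n) (extChartAt 𝓘(ℝ, Eu n) p).symm x

theorem symm_pt (p : M) : (extChartAt 𝓘(ℝ, Eu n) p).symm (pt n p) = p :=
  extChartAt_to_inv p

theorem pt_mem_target (p : M) : pt n p ∈ (extChartAt 𝓘(ℝ, Eu n) p).target :=
  mem_extChartAt_target p

variable [IsManifold 𝓘(ℝ, Eu n) ∞ M]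

/-- The right side is typed over `Eu n` rather than over tangent spaces, so that base points can be
rewritten in it. -/
theorem localMetric_apply (g : RiemMetric n M) (p : M) (x v w : Eu n) :
    localMetric g p x v w = metricAt g ((extChartAt 𝓘(ℝ, Eu n) p).symm x)
      (symmDeriv p x v) (symmDeriv p x w) := rfl

theorem isManifold_one : IsManifold 𝓘(ℝ, Eu n) 1 M :=
  IsManifold.of_le (n := ∞) (by exact_mod_cast le_top)

theorem injective_symmDeriv {p : M} {x : Eu n} (hx : x ∈ (extChartAt 𝓘(ℝ, Eu n) p).target) :
    Function.Injective (symmDeriv p x) := by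
  have := isManifold_one (n := n) (M := M)
  have h := isInvertible_mfderivWithin_extChartAt_symm hx
  rw [modelWithCornersSelf_coe, Set.range_id, mfderivWithin_univ] at h
  exact h.injective

theorem symmDeriv_coord (p : M) (v : TangentSpace 𝓘(ℝ, Eu n) p) :
    symmDeriv p (pt n p) (coord p v) = v := by
  have := isManifold_one (n := n) (M := M)
  have h := mfderivWithin_extChartAt_symm_comp_mfderiv_extChartAt' (I := 𝓘(ℝ, Eu n))
    (mem_extChartAt_source (I := 𝓘(ℝ, Eu n)) p)
  rw [modelWithCornersSelf_coe, Set.range_id, mfderivWithin_univ] at h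
  exact congrArg (fun L => L v) h

theorem coord_symmDeriv (p : M) (v : Eu n) :
    coord p (symmDeriv p (pt n p) v : TangentSpace 𝓘(ℝ, Eu n) p) = v := by
  have := isManifold_one (n := n) (M := M)
  have h := mfderiv_extChartAt_comp_mfderivWithin_extChartAt_symm' (I := 𝓘(ℝ, Eu n))
    (mem_extChartAt_source (I := 𝓘(ℝ, Eu n)) p)
  rw [modelWithCornersSelf_coe, Set.range_id, mfderivWithin_univ] at h
  exact congrArg (fun L => L v) h

/-- The tangent map of the inverse chart, composed with a constant vector field. -/
theorem contMDiffOn_symmDeriv (p : M) (v : Eu n) :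
    ContMDiffOn 𝓘(ℝ, Eu n) 𝓘(ℝ, Eu n).tangent ∞
      (fun x => (⟨(extChartAt 𝓘(ℝ, Eu n) p).symm x, symmDeriv p x v⟩ :
        TangentBundle 𝓘(ℝ, Eu n) M)) (extChartAt 𝓘(ℝ, Eu n) p).target := by
  have hopen := isOpen_extChartAt_target (I := 𝓘(ℝ, Eu n)) p
  have h1 := (contMDiffOn_extChartAt_symm (I := 𝓘(ℝ, Eu n)) (n := ∞) p).contMDiffOn_tangentMapWithin
    (m := ∞) (by simp) hopen.uniqueMDiffOn
  have h2 : ContMDiff 𝓘(ℝ, Eu n) 𝓘(ℝ, Eu n).tangent ∞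
      (fun x : Eu n => (⟨x, v⟩ : TangentBundle 𝓘(ℝ, Eu n) (Eu n))) :=
    contMDiff_vectorSpace_iff_contDiff.2 contDiff_const
  refine (h1.comp h2.contMDiffOn fun x hx => hx).congr fun x hx => ?_
  simp only [Function.comp, tangentMapWithin, symmDeriv, mfderivWithin_of_isOpen hopen hx]
  rfl

/-- The local expression of a Riemannian metric is a Riemannian metric on the domain of the
chart. -/
theorem isMetricOn_localMetric (g : RiemMetric n M) (p : M) :
    Loc.IsMetricOn (localMetric g p) (extChartAt 𝓘(ℝ, Eu n) p).target where
  isOpen := isOpen_extChartAt_target p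
  symm y _ v w := g.symm _ _ _
  pos y hy v hv := g.pos _ _ fun h0 => hv (injective_symmDeriv hy (h0.trans (map_zero _).symm))
  contDiffAt := by
    have hopen := isOpen_extChartAt_target (I := 𝓘(ℝ, Eu n)) p
    suffices H : ContDiffOn ℝ ∞ (localMetric g p) (extChartAt 𝓘(ℝ, Eu n) p).target from
      fun y hy => H.contDiffAt (hopen.mem_nhds hy)
    refine contDiffOn_clm_apply.2 fun v => contDiffOn_clm_apply.2 fun w => ?_
    rw [← contMDiffOn_iff_contDiffOn]
    intro x hx
    have h0 : ContMDiffWithinAt 𝓘(ℝ, Eu n) 𝓘(ℝ, Eu n) ∞ (extChartAt 𝓘(ℝ, Eu n) p).symm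
      (extChartAt 𝓘(ℝ, Eu n) p).target x := contMDiffOn_extChartAt_symm p x hx
    have : ContMDiffWithinAt 𝓘(ℝ, Eu n) (𝓘(ℝ, Eu n).prod 𝓘(ℝ)) ∞
        (fun x => Bundle.TotalSpace.mk' ℝ (E := Bundle.Trivial M ℝ)
          ((extChartAt 𝓘(ℝ, Eu n) p).symm x)
          (g.inner ((extChartAt 𝓘(ℝ, Eu n) p).symm x) (symmDeriv p x v) (symmDeriv p x w)))
        (extChartAt 𝓘(ℝ, Eu n) p).target x := by
      apply ContMDiffWithinAt.clm_bundle_apply₂ (F₁ := Eu n) (F₂ := Eu n)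
      · exact ContMDiffAt.comp_contMDiffWithinAt x g.contMDiff.contMDiffAt h0
      · exact contMDiffOn_symmDeriv p v x hx
      · exact contMDiffOn_symmDeriv p w x hx
    simp only [Bundle.contMDiffWithinAt_totalSpace] at this
    exact this.2

theorem localMetric_pt (g : RiemMetric n M) (p : M) (v w : TangentSpace 𝓘(ℝ, Eu n) p) :
    localMetric g p (pt n p) (coord p v) (coord p w) = g.inner p v w := by
  rw [localMetric_apply, symmDeriv_coord, symmDeriv_coord, symm_pt]
  rfl

theorem isConformalOn_localMetric {g gbar : RiemMetric n M} {φ : M → ℝ}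
    (hφ : ContMDiff 𝓘(ℝ, Eu n) 𝓘(ℝ, ℝ) ∞ φ)
    (hconf : ∀ (p : M) (v w : TangentSpace 𝓘(ℝ, Eu n) p),
      gbar.inner p v w = Real.exp (-2 * φ p) * g.inner p v w) (p : M) :
    Loc.IsConformalOn (localMetric g p) (localMetric gbar p)
      (fun x => φ ((extChartAt 𝓘(ℝ, Eu n) p).symm x)) (extChartAt 𝓘(ℝ, Eu n) p).target where
  left := isMetricOn_localMetric g p
  right := isMetricOn_localMetric gbar p
  smooth y hy := by
    rw [← contMDiffAt_iff_contDiffAt]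
    exact hφ.contMDiffAt.comp y ((contMDiffOn_extChartAt_symm p).contMDiffAt
      ((isOpen_extChartAt_target p).mem_nhds hy))
  eq y _ := by
    ext v w
    exact hconf _ _ _

/-- The transition map from the chart around `p` to the chart around `q` is an isometry. -/
theorem isIsometryOn_transition (g : RiemMetric n M) (p q : M) :
    Loc.IsIsometryOn (fun x => extChartAt 𝓘(ℝ, Eu n) q ((extChartAt 𝓘(ℝ, Eu n) p).symm x))
      (localMetric g p) ((extChartAt 𝓘(ℝ, Eu n) p).target ∩
        (extChartAt 𝓘(ℝ, Eu n) p).symm ⁻¹' (extChartAt 𝓘(ℝ, Eu n) q).source)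
      (localMetric g q) (extChartAt 𝓘(ℝ, Eu n) q).target := by
  have hopen : IsOpen ((extChartAt 𝓘(ℝ, Eu n) p).target ∩
        (extChartAt 𝓘(ℝ, Eu n) p).symm ⁻¹' (extChartAt 𝓘(ℝ, Eu n) q).source) :=
    (continuousOn_extChartAt_symm p).isOpen_inter_preimage (isOpen_extChartAt_target p)
      (isOpen_extChartAt_source q)
  have hs : ∀ (p : M) (y : Eu n), y ∈ (extChartAt 𝓘(ℝ, Eu n) p).target →
      ContMDiffAt 𝓘(ℝ, Eu n) 𝓘(ℝ, Eu n) ∞ (extChartAt 𝓘(ℝ, Eu n) p).symm y := fun p y hy =>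
    (contMDiffOn_extChartAt_symm p).contMDiffAt ((isOpen_extChartAt_target p).mem_nhds hy)
  have hF : ∀ y ∈ (extChartAt 𝓘(ℝ, Eu n) p).target ∩
        (extChartAt 𝓘(ℝ, Eu n) p).symm ⁻¹' (extChartAt 𝓘(ℝ, Eu n) q).source,
      ContDiffAt ℝ ∞ (fun x => extChartAt 𝓘(ℝ, Eu n) q ((extChartAt 𝓘(ℝ, Eu n) p).symm x)) y := by
    intro y hy
    rw [← contMDiffAt_iff_contDiffAt]
    exact (contMDiffAt_extChartAt' (by simpa using hy.2)).comp y (hs p y hy.1)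
  refine ⟨(isMetricOn_localMetric g p).mono hopen Set.inter_subset_left,
    isMetricOn_localMetric g q, fun y hy => (extChartAt 𝓘(ℝ, Eu n) q).map_source hy.2, hF,
    fun y hy v w => ?_⟩
  have hinv := (extChartAt 𝓘(ℝ, Eu n) q).left_inv hy.2
  -- Chain rule for the inverse chart at q after the transition map, which near y is the inverse
  -- chart at p.
  have hD : ∀ v, symmDeriv q (extChartAt 𝓘(ℝ, Eu n) q ((extChartAt 𝓘(ℝ, Eu n) p).symm y))
      (fderiv ℝ (fun x => extChartAt 𝓘(ℝ, Eu n) q ((extChartAt 𝓘(ℝ, Eu n) p).symm x)) y v)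
      = symmDeriv p y v := by
    intro v
    have hE : (fun x => (extChartAt 𝓘(ℝ, Eu n) q).symm
        (extChartAt 𝓘(ℝ, Eu n) q ((extChartAt 𝓘(ℝ, Eu n) p).symm x)))
        =ᶠ[𝓝 y] (extChartAt 𝓘(ℝ, Eu n) p).symm := by
      filter_upwards [hopen.mem_nhds hy] with x hx using (extChartAt 𝓘(ℝ, Eu n) q).left_inv hx.2
    have h1 := (hs q _ ((extChartAt 𝓘(ℝ, Eu n) q).map_source hy.2)).mdifferentiableAt
      (by simp) |>.hasMFDerivAt
    have h2 := ((hF y hy).differentiableAt (by simp)).hasFDerivAt.hasMFDerivAt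
    have h3 := (HasMFDerivAt.comp y h1 h2).congr_of_eventuallyEq hE.symm
    exact congrArg (fun L : Eu n →L[ℝ] Eu n => L v) h3.mfderiv.symm
  rw [localMetric_apply, localMetric_apply, hD, hD, hinv]

theorem mfderiv_eq_fderiv_comp {φ : M → ℝ} (hφ : ContMDiff 𝓘(ℝ, Eu n) 𝓘(ℝ, ℝ) ∞ φ) (p : M)
    (v : Eu n) :
    fderiv ℝ (fun x => φ ((extChartAt 𝓘(ℝ, Eu n) p).symm x)) (pt n p) v
      = (mfderiv 𝓘(ℝ, Eu n) 𝓘(ℝ, ℝ) φ p : Eu n →L[ℝ] ℝ) (symmDeriv p (pt n p) v) := by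
  have h1 := ((contMDiffOn_extChartAt_symm (I := 𝓘(ℝ, Eu n)) (n := ∞) p).contMDiffAt
    ((isOpen_extChartAt_target p).mem_nhds (pt_mem_target p))).mdifferentiableAt
      (by simp) |>.hasMFDerivAt
  have h2 : HasMFDerivAt 𝓘(ℝ, Eu n) 𝓘(ℝ, ℝ) φ ((extChartAt 𝓘(ℝ, Eu n) p).symm (pt n p))
      (mfderiv 𝓘(ℝ, Eu n) 𝓘(ℝ, ℝ) φ p : Eu n →L[ℝ] ℝ) := by
    rw [symm_pt]
    exact (hφ.mdifferentiableAt (by simp)).hasMFDerivAt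
  have h3 : HasMFDerivAt 𝓘(ℝ, Eu n) 𝓘(ℝ, ℝ)
      (fun x => φ ((extChartAt 𝓘(ℝ, Eu n) p).symm x)) (pt n p)
      ((mfderiv 𝓘(ℝ, Eu n) 𝓘(ℝ, ℝ) φ p : Eu n →L[ℝ] ℝ).comp (symmDeriv p (pt n p))) :=
    HasMFDerivAt.comp (pt n p) h2 h1
  rw [← mfderiv_eq_fderiv]
  exact congrArg (fun L : Eu n →L[ℝ] ℝ => L v) h3.mfderiv

theorem inner_grad (g : RiemMetric n M) (φ : M → ℝ) (p : M) (v : TangentSpace 𝓘(ℝ, Eu n) p) :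
    g.inner p (grad g φ p) v = mfderiv 𝓘(ℝ, Eu n) 𝓘(ℝ, ℝ) φ p v := by
  have h : (metricAt g p).IsInvertible := Loc.isInvertible_of_pos (g.pos p)
  exact congrArg (fun L : Eu n →L[ℝ] ℝ => L v) (h.self_apply_inverse _)

theorem coord_grad (g : RiemMetric n M) {φ : M → ℝ}
    (hφ : ContMDiff 𝓘(ℝ, Eu n) 𝓘(ℝ, ℝ) ∞ φ) (p : M) :
    coord p (grad g φ p) = Loc.gradient (localMetric g p)
      (fun x => φ ((extChartAt 𝓘(ℝ, Eu n) p).symm x)) (pt n p) := by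
  have hG := isMetricOn_localMetric g p
  refine hG.ext_left (pt_mem_target p) fun z => ?_
  rw [Loc.gradient, hG.apply_sharp (pt_mem_target p), mfderiv_eq_fderiv_comp hφ]
  have h1 := localMetric_pt g p (grad g φ p) (symmDeriv p (pt n p) z)
  rw [coord_symmDeriv] at h1
  exact h1.trans (inner_grad g φ p _)

/-! ### The nullity of the Weyl tensor -/

namespace Loc

variable {n : ℕ} {G : LocalMetric n} {U : Set (Eu n)} {x : Eu n}

/-- The linear map with the components `W(·, eᵢ, eⱼ, eₖ)`. -/
def weylMap (G : LocalMetric n) (x : Eu n) : Eu n →L[ℝ] (Fin n × Fin n × Fin n → ℝ) :=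
  ∑ l, (eps l).smulRight fun t => weyl G x (e l) (e t.1) (e t.2.1) (e t.2.2)

theorem weylMap_apply (v : Eu n) (t : Fin n × Fin n × Fin n) :
    weylMap G x v t = weyl G x v (e t.1) (e t.2.1) (e t.2.2) := by
  rw [← sum_eps_mul (isLinearMap_weyl₁ _ _ _) v]
  simp [weylMap]

/-- The nullity space of the Weyl tensor. -/
def weylKer (G : LocalMetric n) (x : Eu n) : Submodule ℝ (Eu n) :=
  LinearMap.ker (weylMap G x).toLinearMap

theorem IsMetricOn.mem_weylKer (hG : IsMetricOn G U) (hx : x ∈ U) {v : Eu n} :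
    v ∈ weylKer G x ↔ ∀ a b c, weyl G x v a b c = 0 := by
  change weylMap G x v = 0 ↔ _
  constructor
  · intro h0 a b c
    have h1 : ∀ i j k, weyl G x v (e i) (e j) (e k) = 0 := fun i j k => by
      rw [← weylMap_apply v (i, j, k), h0]; rfl
    rw [← sum_eps_smul_e a, ← sum_eps_smul_e b, ← sum_eps_smul_e c]
    simp only [← sum_mul_isLinearMap (isLinearMap_weyl₂ _ _ _),
      ← sum_mul_isLinearMap (hG.isLinearMap_weyl₃ hx _ _ _),
      ← sum_mul_isLinearMap (hG.isLinearMap_weyl₄ hx _ _ _), h1]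
    simp
  · intro h0
    ext t
    rw [weylMap_apply, h0]
    rfl

theorem IsMetricOn.continuousAt_weylMap (hG : IsMetricOn G U) (hx : x ∈ U) :
    ContinuousAt (weylMap G) x := by
  refine tendsto_finsetSum _ fun l _ => ?_
  have h1 : ContinuousAt (fun y => fun t : Fin n × Fin n × Fin n =>
      weyl G y (e l) (e t.1) (e t.2.1) (e t.2.2)) x :=
    continuousAt_pi.2 fun t => (hG.contDiffAt_weyl hx _ _ _ _).continuousAt
  exact ((ContinuousLinearMap.smulRightL ℝ (Eu n) (Fin n × Fin n × Fin n → ℝ)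
    (eps l)).continuous.continuousAt).comp h1

/-- The dimension of the nullity space is upper semicontinuous. -/
theorem IsMetricOn.eventually_finrank_weylKer_le (hG : IsMetricOn G U) (hx : x ∈ U) :
    ∀ᶠ y in 𝓝 x, Module.finrank ℝ (weylKer G y) ≤ Module.finrank ℝ (weylKer G x) := by
  -- Rank cannot drop under small perturbations; rank-nullity turns this into a bound for the
  -- kernel.
  have ho := isOpen_setOfPred_nat_le_rank (𝕜 := ℝ) (E := Eu n)
    (F := Fin n × Fin n × Fin n → ℝ)
    (Module.finrank ℝ (LinearMap.range (weylMap G x).toLinearMap))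
  filter_upwards [(hG.continuousAt_weylMap hx).eventually (ho.mem_nhds
    (Module.finrank_eq_rank ℝ (LinearMap.range (weylMap G x).toLinearMap)).le)] with y hy
  have h1 : Module.finrank ℝ (LinearMap.range (weylMap G x).toLinearMap)
      ≤ Module.finrank ℝ (LinearMap.range (weylMap G y).toLinearMap) := by
    have h2 : _ ≤ Module.rank ℝ (LinearMap.range (weylMap G y).toLinearMap) := hy
    rw [← Module.finrank_eq_rank ℝ (LinearMap.range (weylMap G y).toLinearMap)] at h2
    exact_mod_cast h2
  have h3 := LinearMap.finrank_range_add_finrank_ker (weylMap G x).toLinearMap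
  have h4 := LinearMap.finrank_range_add_finrank_ker (weylMap G y).toLinearMap
  have h5 : Module.finrank ℝ (LinearMap.ker (weylMap G y).toLinearMap)
      ≤ Module.finrank ℝ (LinearMap.ker (weylMap G x).toLinearMap) := by omega
  exact h5

end Loc

/-! ### The dimension of 𝓔 on the manifold, and openness and density of M_𝓔. -/

section Nullity

variable {n : ℕ} {M : Type*} [TopologicalSpace M] [ChartedSpace (Eu n) M]
  [IsManifold 𝓘(ℝ, Eu n) ∞ M]

/-- The preferred chart around `p` as an isomorphism of the tangent space at `p`. -/
def coordEquiv (p : M) : TangentSpace 𝓘(ℝ, Eu n) p ≃ₗ[ℝ] Eu n where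
  toFun := coord p
  map_add' := map_add _
  map_smul' := map_smul _
  invFun v := symmDeriv p (pt n p) v
  left_inv := symmDeriv_coord p
  right_inv := coord_symmDeriv p

theorem finrank_eq_of_mem_iff {V W : Type*} [AddCommGroup V] [Module ℝ V] [AddCommGroup W]
    [Module ℝ W] (f : V ≃ₗ[ℝ] W) {A : Submodule ℝ V} {B : Submodule ℝ W}
    (h : ∀ v, v ∈ A ↔ f v ∈ B) : Module.finrank ℝ A = Module.finrank ℝ B := by
  have hB : A.map (f : V →ₗ[ℝ] W) = B := by
    ext w
    rw [Submodule.mem_map]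
    refine ⟨fun ⟨v, hv, hw⟩ => hw ▸ (h v).1 hv, fun hw => ⟨f.symm w, (h _).2 ?_, ?_⟩⟩
    · rwa [f.apply_symm_apply]
    · exact f.apply_symm_apply w
  rw [← hB, LinearEquiv.finrank_map_eq]

theorem finrank_nullity (g : RiemMetric n M) (q : M) : Module.finrank ℝ (nullity g q)
    = Module.finrank ℝ (Loc.weylKer (localMetric g q) (pt n q)) := by
  refine finrank_eq_of_mem_iff (coordEquiv q) fun v => ?_
  refine Iff.trans ?_ ((isMetricOn_localMetric g q).mem_weylKer (pt_mem_target q)).symm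
  refine ⟨fun h0 a b c => ?_, fun h0 a b c => h0 _ _ _⟩
  have h2 := h0 ((coordEquiv q).symm a) ((coordEquiv q).symm b) ((coordEquiv q).symm c)
  change Loc.weyl _ _ _ (coordEquiv q _) (coordEquiv q _) (coordEquiv q _) = 0 at h2
  rwa [LinearEquiv.apply_symm_apply, LinearEquiv.apply_symm_apply,
    LinearEquiv.apply_symm_apply] at h2

/-- Brings all points near p into the single chart at p, as semicontinuity requires; the transition
isometry identifies the two kernels. -/
theorem finrank_nullity_of_mem_source (g : RiemMetric n M) {p q : M}
    (hq : q ∈ (extChartAt 𝓘(ℝ, Eu n) p).source) : Module.finrank ℝ (nullity g q)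
    = Module.finrank ℝ (Loc.weylKer (localMetric g p) (extChartAt 𝓘(ℝ, Eu n) p q)) := by
  have h := isIsometryOn_transition g p q
  have hinv := (extChartAt 𝓘(ℝ, Eu n) p).left_inv hq
  have hx : extChartAt 𝓘(ℝ, Eu n) p q ∈ (extChartAt 𝓘(ℝ, Eu n) p).target ∩
      (extChartAt 𝓘(ℝ, Eu n) p).symm ⁻¹' (extChartAt 𝓘(ℝ, Eu n) q).source := by
    refine ⟨(extChartAt 𝓘(ℝ, Eu n) p).map_source hq, ?_⟩
    rw [Set.mem_preimage, hinv]
    exact mem_extChartAt_source q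
  have hb := h.bijective hx
  have hpt : extChartAt 𝓘(ℝ, Eu n) q
      ((extChartAt 𝓘(ℝ, Eu n) p).symm (extChartAt 𝓘(ℝ, Eu n) p q)) = pt n q := by
    rw [hinv]
    rfl
  rw [finrank_nullity]
  refine (finrank_eq_of_mem_iff (LinearEquiv.ofBijective
    (fderiv ℝ _ (extChartAt 𝓘(ℝ, Eu n) p q)).toLinearMap hb) fun v => ?_).symm
  rw [h.left.mem_weylKer hx, h.right.mem_weylKer (pt_mem_target q)]
  simp only [h.weyl_eq hx, hpt]
  exact ⟨fun h0 a b c => by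
    obtain ⟨a, rfl⟩ := hb.2 a
    obtain ⟨b, rfl⟩ := hb.2 b
    obtain ⟨c, rfl⟩ := hb.2 c
    exact h0 a b c, fun h0 a b c => h0 _ _ _⟩

theorem eventually_finrank_nullity_le (g : RiemMetric n M) (p : M) :
    ∀ᶠ q in 𝓝 p, Module.finrank ℝ (nullity g q) ≤ Module.finrank ℝ (nullity g p) := by
  have h1 := (isMetricOn_localMetric g p).eventually_finrank_weylKer_le (pt_mem_target p)
  have h2 : ContinuousAt (extChartAt 𝓘(ℝ, Eu n) p) p := continuousAt_extChartAt p
  filter_upwards [h2.eventually h1, extChartAt_source_mem_nhds (I := 𝓘(ℝ, Eu n)) p] with q hq hq'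
  rw [finrank_nullity_of_mem_source g hq', finrank_nullity g p]
  exact hq

theorem isOpen_constRankSet (g : RiemMetric n M) : IsOpen (constRankSet g) := by
  rw [isOpen_iff_mem_nhds]
  intro p hp
  filter_upwards [hp.eventually_nhds, hp] with q hq hq'
  filter_upwards [hq] with r hr
  rw [hr, hq']

/-- In a nonempty open set, a point of minimal nullity has locally constant nullity: semicontinuity
bounds it above, minimality below. -/
theorem dense_constRankSet (g : RiemMetric n M) : Dense (constRankSet g) := by
  rw [dense_iff_inter_open]
  intro V hV hne
  obtain ⟨p, hp, hmin⟩ := exists_minimalFor_of_wellFoundedLT (· ∈ V)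
    (fun q => Module.finrank ℝ (nullity g q)) hne
  refine ⟨p, hp, ?_⟩
  filter_upwards [hV.mem_nhds hp, eventually_finrank_nullity_le g p] with q hq hq'
  exact le_antisymm hq' (hmin hq hq')

end Nullity

/-! ### Conformal behaviour of 𝓔, 𝕋 and C_𝕋 on the manifold. -/

section Conformal

variable {n : ℕ} {M : Type*} [TopologicalSpace M] [ChartedSpace (Eu n) M]
  [IsManifold 𝓘(ℝ, Eu n) ∞ M] {g gbar : RiemMetric n M} {φ : M → ℝ}
  (hn : 3 ≤ n) (hφ : ContMDiff 𝓘(ℝ, Eu n) 𝓘(ℝ, ℝ) ∞ φ)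
  (hconf : ∀ (p : M) (v w : TangentSpace 𝓘(ℝ, Eu n) p),
    gbar.inner p v w = Real.exp (-2 * φ p) * g.inner p v w)

include hn hφ hconf

theorem weyl_conformal (p : M) (a b c d : TangentSpace 𝓘(ℝ, Eu n) p) :
    weyl gbar p a b c d = Real.exp (-2 * φ p) * weyl g p a b c d := by
  have h := (isConformalOn_localMetric hφ hconf p).weyl_eq (pt_mem_target p) hn
    (coord p a) (coord p b) (coord p c) (coord p d)
  rwa [symm_pt] at h

theorem nullity_conformal (p : M) : nullity gbar p = nullity g p := by
  ext v
  change (∀ a b c, weyl gbar p v a b c = 0) ↔ ∀ a b c, weyl g p v a b c = 0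
  simp only [weyl_conformal hn hφ hconf, mul_eq_zero, Real.exp_ne_zero, false_or]

theorem constRankSet_conformal : constRankSet gbar = constRankSet g := by
  have h : ∀ q, Module.finrank ℝ (nullity gbar q) = Module.finrank ℝ (nullity g q) := fun q => by
    rw [nullity_conformal hn hφ hconf]
  simp only [constRankSet, h]

omit hn in
theorem fieldT_conformal (hn : 4 ≤ n) (p : M) :
    fieldT gbar p = Real.exp (φ p) ^ 2 • (fieldT g p - perpPart g p (grad g φ p)) := by
  have h := isConformalOn_localMetric hφ hconf p
  obtain ⟨P, hP1, hP2, hP3⟩ := h.fieldT_eq (pt_mem_target p) hn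
  have hG := isMetricOn_localMetric g p
  let Q : TangentSpace 𝓘(ℝ, Eu n) p := symmDeriv p (pt n p) P
  have hQ : coord p Q = P := coord_symmDeriv p P
  have hnull : grad g φ p - Q ∈ nullity g p := fun a b c => by
    change Loc.weyl _ _ (coord p (grad g φ p - Q)) _ _ _ = 0
    rw [map_sub, hQ, coord_grad g hφ]
    exact hP1 _ _ _
  have hperp : Q ∈ perp g p := by
    refine LinearMap.BilinForm.mem_orthogonal_iff.2 fun v hv => ?_
    change g.inner p v Q = 0
    rw [← localMetric_pt, hQ]
    refine hP2 _ fun a b c => ?_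
    have h2 := hv ((coordEquiv p).symm a) ((coordEquiv p).symm b) ((coordEquiv p).symm c)
    change Loc.weyl _ _ _ (coordEquiv p _) (coordEquiv p _) (coordEquiv p _) = 0 at h2
    rwa [LinearEquiv.apply_symm_apply, LinearEquiv.apply_symm_apply,
      LinearEquiv.apply_symm_apply] at h2
  -- Q lies in 𝓔^⊥ and differs from the gradient by an element of 𝓔, which determines the
  -- projection.
  have hproj : perpPart g p (grad g φ p) = Q := by
    have h1 : grad g φ p = Q + (grad g φ p - Q) := by abel
    rw [perpPart, h1, map_add, Submodule.projection_apply_of_mem_left _ hperp]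
    rw [(Submodule.projection_apply_eq_zero_iff _).2 hnull, add_zero]
  have hexp : Real.exp (2 * φ p) = Real.exp (φ p) ^ 2 := by
    rw [← Real.exp_nat_mul]; norm_num
  rw [hproj, ← hexp]
  have h1 := congrArg (symmDeriv p (pt n p)) hP3
  rw [symm_pt, map_smul, map_sub] at h1
  exact h1

theorem modCotton_conformal (p : M) (a b c : TangentSpace 𝓘(ℝ, Eu n) p) :
    modCotton gbar p a b c = modCotton g p a b c := by
  have h := isConformalOn_localMetric hφ hconf p
  have hx := pt_mem_target (n := n) p
  have hG := isMetricOn_localMetric g p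
  have hT : ∀ g : RiemMetric n M, weyl g p a b c (fieldT g p) = Loc.weyl (localMetric g p) (pt n p)
      (coord p a) (coord p b) (coord p c) (Loc.fieldT (localMetric g p) (pt n p)) := fun g =>
    congrArg (Loc.weyl (localMetric g p) (pt n p) (coord p a) (coord p b) (coord p c))
      (coord_symmDeriv p _)
  rw [modCotton, modCotton, hT, hT, dSchouten, dSchouten, h.dSchouten_eq hx hn, h.weyl_eq hx hn]
  rcases hn.eq_or_lt with h3 | h4
  · simp only [hG.weyl_eq_zero_of_dim_three hx h3.symm]
    simp
  · obtain ⟨P, hP1, -, hP3⟩ := h.fieldT_eq hx h4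
    have l4 := hG.isLinearMap_weyl₄ hx (coord p a) (coord p b) (coord p c)
    -- After moving the slot, this says W(a,b,c,∇φ) = W(a,b,c,P); as e^{-2φ} e^{2φ} = 1, the
    -- corrections of d^∇𝔨 and of the 𝕋-term then cancel.
    have h0 := hP1 (coord p c) (coord p a) (coord p b)
    rw [hG.weyl_pair hx, hG.weyl_swap₃₄ hx, neg_eq_zero, l4.map_sub, sub_eq_zero] at h0
    rw [hP3, l4.map_smul, l4.map_sub, ← h0, smul_eq_mul, ← mul_assoc, ← Real.exp_add, neg_mul,
      neg_add_cancel, Real.exp_zero]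
    ring

end Conformal

end ConformalCotton

end

theorem mainTheorem2 {n : ℕ} (hn : 3 ≤ n) {M : Type*} [TopologicalSpace M]
    [ChartedSpace (EuclideanSpace ℝ (Fin n)) M]
    [IsManifold 𝓘(ℝ, EuclideanSpace ℝ (Fin n)) ∞ M]
    (g gbar : ConformalCotton.RiemMetric n M) (φ : M → ℝ)
    (hφ : ContMDiff 𝓘(ℝ, EuclideanSpace ℝ (Fin n)) 𝓘(ℝ, ℝ) ∞ φ)
    (hconf : ∀ (p : M) (v w : TangentSpace 𝓘(ℝ, EuclideanSpace ℝ (Fin n)) p),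
      gbar.inner p v w = Real.exp (-2 * φ p) * g.inner p v w) :
    IsOpen (ConformalCotton.constRankSet g) ∧
    Dense (ConformalCotton.constRankSet g) ∧
    ConformalCotton.constRankSet gbar = ConformalCotton.constRankSet g ∧
    (∀ p ∈ ConformalCotton.constRankSet g,
      ∀ a b c : TangentSpace 𝓘(ℝ, EuclideanSpace ℝ (Fin n)) p,
        ConformalCotton.modCotton gbar p a b c = ConformalCotton.modCotton g p a b c) ∧
    (4 ≤ n → ∀ p ∈ ConformalCotton.constRankSet g,
      ConformalCotton.fieldT gbar p = Real.exp (φ p) ^ 2 •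
        (ConformalCotton.fieldT g p
          - ConformalCotton.perpPart g p (ConformalCotton.grad g φ p))) :=
  ⟨ConformalCotton.isOpen_constRankSet g, ConformalCotton.dense_constRankSet g,
    ConformalCotton.constRankSet_conformal hn hφ hconf,
    fun p _ a b c => ConformalCotton.modCotton_conformal hn hφ hconf p a b c,
    fun h4 p _ => ConformalCotton.fieldT_conformal hφ hconf h4 p⟩
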